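/- Let $\ell,p,m,k$ be positive integers with $k\le\min(p,m)$. Let $X\in\mathbb R^{\ell\times p}$ and $B\in\mathbb R^{p\times m}$ be deterministic, let $s>0$ satisfy $s^2\sqrt m\le \ell p$, and observe $Y=XB+\mathcal E$, where the entries of the random $\ell\times m$ matrix $\mathcal E$ are i.i.d. and centered. Assume that one of the following holds: (A1) the entries of $\mathcal E$ are $\mathcal N(0,\sigma^2)$ with $\sigma^2\le s^2$; (A2) the law of the entries is supported by a compact interval $[-\zeta,\zeta]$ and has there a density $f$ with respect to Lebesgue measure with $f\ge f_{\min}>0$ on $[-\zeta,\zeta]$, and $\mathbb E|\mathcal E_{1,1}|/(2f_{\min})\le s^2$. Let $a=1$, $b=\frac{s^2}{2\ell pk^2(m^2+p^2)}$, $\lambda=\frac1{4s^2}$. Let $\pi$ be the following prior on pairs $(M,N)\in\mathbb R^{p\times k}\times\mathbb R^{m\times k}$: the variables $1/\gamma_1,\dots,1/\gamma_k$ are i.i.d. $\mathrm{Gamma}(a,b)$ (shape $a$, rate $b$) and, given $\gamma_1,\dots,\gamma_k$, all entries of $M$ and $N$ are independent, those in the $j$-th columns $M_j$ and $N_j$ being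 $\mathcal N(0,\gamma_j)$. Let $\hat\rho_\lambda(d(M,N))\propto\exp(-\lambda\|Y-XMN^T\|_F^2)\,\pi(d(M,N))$ and $\hat B_\lambda=\int MN^T\,\hat\rho_\lambda(d(M,N))$. If $X\neq0$, this integral converges absolutely for every value of $Y$; if $X=0$, $X\hat B_\lambda$ is read as $0$. Then $\|X\hat B_\lambda-XB\|_F^2$ is integrable and $$\begin{aligned}\mathbb E\|X\hat B_\lambda-XB\|_F^2\le\inf_{J,M,N}\Big\{&\|X(MN^T-B)\|_F^2+6s^2(m+p)|J|\log\Big(\frac{1.34\,\ell p}{s^2}\Big)+8s^2k\log\Big(\frac{22.17\,\ell pk^2(m^2+p^2)}{s^2}\Big)\\&+\frac{2s^2\|X\|_F^2}{\ell p}\Big(\|N\|_F^2+\|M\|_F^2+\frac{2s^2}{\ell p}+16s^2\Big)+8s^2\big(\|N\|_F^2+\|M\|_F^2+\log 2\big)\Big\},\end{aligned}$$ where the infimum is over all $J\subseteq\{1,\dots,k\}$, $M\in\mathbb R^{p\times k}$ and $N\in\mathbb R^{m\times k}$ such that $M_j=0$ and $N_j=0$ for every $j\notin J$. -/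

import Mathlib

open MeasureTheory ProbabilityTheory
open scoped NNReal ENNReal Matrix

namespace ReducedRank

/-- Squared Frobenius norm of a real matrix. -/
def frobSq {q r : ℕ} (A : Matrix (Fin q) (Fin r) ℝ) : ℝ := ∑ i, ∑ j, A i j ^ 2

/-- The space of pairs `(M, N)`, where `M` is `p × k` and `N` is `m × k`. -/
abbrev Pairs (p m k : ℕ) : Type := (Fin p → Fin k → ℝ) × (Fin m → Fin k → ℝ)

/-- The matrix `M Nᵀ`. -/
def prodMat {p m k : ℕ} (θ : Pairs p m k) : Matrix (Fin p) (Fin m) ℝ :=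
  Matrix.of θ.1 * (Matrix.of θ.2)ᵀ

/-- The inverse-Gamma law: the law of `γ` when `1/γ ∼ Gamma(a, b)` (shape `a`, rate `b`), that is,
the law with density `b ^ a / Γ(a) * γ ^ (-a-1) * exp (-b/γ)` on `γ > 0`. -/
noncomputable def invGammaMeasure (a b : ℝ) : Measure ℝ :=
  (gammaMeasure a b).map (fun x => x⁻¹)

/-- The law of a `q × k` matrix with independent entries, those of the `j`-th column being
`N(0, γ j)`. -/
noncomputable def colGaussian (q k : ℕ) (γ : Fin k → ℝ) : Measure (Fin q → Fin k → ℝ) :=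
  Measure.pi fun _ => Measure.pi fun j => gaussianReal 0 (γ j).toNNReal

/-- The conditional prior `π(M, N | Γ)` with `Γ = diag γ`. -/
noncomputable def priorGiven (p m k : ℕ) (γ : Fin k → ℝ) : Measure (Pairs p m k) :=
  (colGaussian p k γ).prod (colGaussian m k γ)

/-- The law `π(Γ)`: the `γ j` are i.i.d. inverse-Gamma. -/
noncomputable def hyperPrior (k : ℕ) (a b : ℝ) : Measure (Fin k → ℝ) :=
  Measure.pi fun _ => invGammaMeasure a b

/-- The hierarchical prior `π(M, N) = ∫ π(M, N | Γ) π(dΓ)`. -/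
noncomputable def prior (p m k : ℕ) (a b : ℝ) : Measure (Pairs p m k) :=
  (hyperPrior k a b).bind (priorGiven p m k)

/-- The quasi-posterior, proportional to `exp (-lam * ‖Y - X M Nᵀ‖²) π(d(M, N))`. -/
noncomputable def quasiPosterior {l p m : ℕ} (k : ℕ) (a b lam : ℝ)
    (X : Matrix (Fin l) (Fin p) ℝ) (Y : Matrix (Fin l) (Fin m) ℝ) : Measure (Pairs p m k) :=
  (prior p m k a b).tilted fun θ => -lam * frobSq (Y - X * prodMat θ)

/-- The quasi-posterior mean of `M Nᵀ` (entrywise integral). -/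
noncomputable def estimator {l p m : ℕ} (k : ℕ) (a b lam : ℝ)
    (X : Matrix (Fin l) (Fin p) ℝ) (Y : Matrix (Fin l) (Fin m) ℝ) : Matrix (Fin p) (Fin m) ℝ :=
  Matrix.of fun i h => ∫ θ, prodMat θ i h ∂(quasiPosterior k a b lam X Y)

/-- The random noise matrix with entries `E i j`, at the outcome `ω`. -/
def noiseMat {l m : ℕ} {Ω : Type*} (E : Fin l → Fin m → Ω → ℝ) (ω : Ω) :
    Matrix (Fin l) (Fin m) ℝ := Matrix.of fun i j => E i j ω

/-- Gaussian noise: the entries are i.i.d. `N(0, v)`, and `s²` is an upper bound for `v`. -/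
def GaussianNoise {l m : ℕ} {Ω : Type*} [MeasurableSpace Ω] (P : Measure Ω)
    (E : Fin l → Fin m → Ω → ℝ) (s : ℝ) : Prop :=
  iIndepFun (fun ij : Fin l × Fin m => E ij.1 ij.2) P ∧
    ∃ v : ℝ≥0, (v : ℝ) ≤ s ^ 2 ∧ ∀ i j, HasLaw (E i j) (gaussianReal 0 v) P

/-- Bounded noise: the entries are i.i.d. and centered, with a law supported by `[-ζ, ζ]` having
there a Lebesgue density bounded below by `fmin > 0`, and `s²` is an upper bound for
`𝔼|ξ| / (2 fmin)`, where `ξ` has the common law of the entries. -/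
def BoundedNoise {l m : ℕ} {Ω : Type*} [MeasurableSpace Ω] (P : Measure Ω)
    (E : Fin l → Fin m → Ω → ℝ) (s : ℝ) : Prop :=
  iIndepFun (fun ij : Fin l × Fin m => E ij.1 ij.2) P ∧
    ∃ (ζ fmin : ℝ) (f : ℝ → ℝ) (ν : Measure ℝ),
      Measurable f ∧ 0 < fmin ∧ (∀ x ∈ Set.Icc (-ζ) ζ, fmin ≤ f x) ∧
      ν = (volume.restrict (Set.Icc (-ζ) ζ)).withDensity (fun x => ENNReal.ofReal (f x)) ∧
      (∀ i j, HasLaw (E i j) ν P) ∧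
      ∫ x, x ∂ν = 0 ∧ (∫ x, |x| ∂ν) / (2 * fmin) ≤ s ^ 2

instance (q k : ℕ) (γ : Fin k → ℝ) : IsProbabilityMeasure (colGaussian q k γ) := by
  unfold colGaussian; infer_instance

instance (p m k : ℕ) (γ : Fin k → ℝ) : IsProbabilityMeasure (priorGiven p m k γ) := by
  unfold priorGiven; infer_instance

/-- A product of probability measures depends measurably on its factors. -/
theorem measurable_pi_measure {β ι : Type*} [MeasurableSpace β] [Fintype ι] {α : ι → Type*}
    [∀ i, MeasurableSpace (α i)] (κ : ∀ i, β → Measure (α i))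
    [∀ i x, IsProbabilityMeasure (κ i x)] (hκ : ∀ i, Measurable (κ i)) :
    Measurable fun x => Measure.pi fun i => κ i x := by
  refine Measurable.measure_of_isPiSystem_of_isProbabilityMeasure
    generateFrom_pi.symm isPiSystem_pi ?_
  rintro _ ⟨s, hs, rfl⟩
  simp only [Measure.pi_pi]
  exact Finset.measurable_prod _ fun i _ =>
    (Measure.measurable_coe (hs i (Set.mem_univ i))).comp (hκ i)

theorem measurable_colGaussian (q k : ℕ) : Measurable (colGaussian q k) := by
  refine measurable_pi_measure (fun _ : Fin q => fun γ : Fin k → ℝ =>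
    Measure.pi fun j => gaussianReal 0 (γ j).toNNReal) fun _ => ?_
  refine measurable_pi_measure (fun j : Fin k => fun γ : Fin k → ℝ =>
    gaussianReal 0 (γ j).toNNReal) fun j => ?_
  have h : Measurable fun γ : Fin k → ℝ => ((0 : ℝ), (γ j).toNNReal) := by fun_prop
  exact measurable_gaussianReal.comp h

/-- The conditional prior is a Markov kernel, so that the mixture `prior` is a genuine one. -/
theorem measurable_priorGiven (p m k : ℕ) : Measurable (priorGiven p m k) := by
  refine Measurable.measure_of_isPiSystem_of_isProbabilityMeasure
    generateFrom_prod.symm isPiSystem_prod ?_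
  rintro _ ⟨s, hs, t, ht, rfl⟩
  simp only [priorGiven, Measure.prod_prod]
  have hs' : MeasurableSet s := hs
  have ht' : MeasurableSet t := ht
  exact ((Measure.measurable_coe hs').comp (measurable_colGaussian p k)).mul
    ((Measure.measurable_coe ht').comp (measurable_colGaussian m k))

/-- For positive hyperparameters the prior is a probability measure. -/
theorem isProbabilityMeasure_prior (p m k : ℕ) {a b : ℝ} (ha : 0 < a) (hb : 0 < b) :
    IsProbabilityMeasure (prior p m k a b) := by
  have := isProbabilityMeasure_gammaMeasure ha hb
  have h1 : IsProbabilityMeasure (invGammaMeasure a b) :=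
    Measure.isProbabilityMeasure_map (by fun_prop)
  have h2 : IsProbabilityMeasure (hyperPrior k a b) := by
    unfold hyperPrior; infer_instance
  constructor
  rw [prior, Measure.bind_apply MeasurableSet.univ (measurable_priorGiven p m k).aemeasurable]
  simp

end ReducedRank

namespace ReducedRank

/-! ### Resampling one coordinate of a product measure -/

/-! The proof joins Stein's risk identity to a PAC-Bayesian bound. Write `y = f + x` for the
observed vector, with `x` the noise, `m` for the Gibbs mean of the regression function and `V` for
the variances of its coordinates.

In one observation `y i` the Gibbs measures form an exponential family with natural parameter `2 *
lam * y i`, so `m i` has partial derivative `2 * lam * V i`, which is nonnegative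
(`hasDerivAt_integral_gibbs`). The mean loss under the Gibbs measure is the squared residual of `m`
plus the sum of the `V i` (`integral_loss_gibbs`). Expanding the risk around the residual leaves `2
𝔼[x i * m i]`; Stein's inequality bounds it by `4 * lam * s ^ 2 * 𝔼[V i]`, and since `4 * lam * s ^
2 = 1` the variances in the loss absorb it (`SteinBound.risk_le`). A bound on the Gibbs loss for
every `y` therefore becomes a risk bound (`oracle_inequality`).

The Gibbs loss is at most minus the log-partition function divided by `lam`. The partition function
is bounded below by keeping only those `γ` that are of order one on `J` and tiny elsewhere, and by
applying Donsker-Varadhan to each conditional prior with a Gaussian law centered at `(M, N)`. Off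
`J` that law is the conditional prior itself and costs nothing, so the entropy counts only the
columns in `J`, while the mass of the hyperprior costs `k * log (22.17 * W)`
(`integral_loss_gibbs_le`).

Absolute convergence needs its own argument, because `1/γ` is exponential and `γ` has infinite mean.
One nonzero entry of `X` suffices: integrating a suitable entry of `M` against the likelihood gives
a bound uniform in `γ` (`lintegral_entry_mul_exp_le`). -/

theorem measurePreserving_update {ι : Type*} [Fintype ι] [DecidableEq ι] {α : ι → Type*}
    [∀ i, MeasurableSpace (α i)] (μ : ∀ i, Measure (α i)) [∀ i, IsProbabilityMeasure (μ i)]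
    (i : ι) :
    MeasurePreserving (fun z : (∀ j, α j) × α i => Function.update z.1 i z.2)
      ((Measure.pi μ).prod (μ i)) (Measure.pi μ) := by
  have hm : Measurable (fun z : (∀ j, α j) × α i => Function.update z.1 i z.2) := by
    refine measurable_pi_iff.2 fun j => ?_
    by_cases h : j = i
    · subst h; simpa using measurable_snd
    · simp only [Function.update_of_ne h]; fun_prop
  refine ⟨hm, (Measure.pi_eq fun s hs => ?_).symm⟩
  rw [Measure.map_apply hm (MeasurableSet.univ_pi hs)]
  have : (fun z : (∀ j, α j) × α i => Function.update z.1 i z.2) ⁻¹' (Set.univ.pi s)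
      = (Set.univ.pi (Function.update s i Set.univ)) ×ˢ (s i) := by
    ext ⟨x, t⟩
    simp only [Set.mem_preimage, Set.mem_pi, Set.mem_univ, true_implies, Set.mem_prod]
    constructor
    · intro h
      refine ⟨fun j => ?_, by simpa using h i⟩
      by_cases hj : j = i
      · subst hj; simp
      · simpa [Function.update_of_ne hj] using h j
    · rintro ⟨h1, h2⟩ j
      by_cases hj : j = i
      · subst hj; simpa using h2
      · simpa [Function.update_of_ne hj] using h1 j
  rw [this, Measure.prod_prod, Measure.pi_pi,
    ← Finset.mul_prod_erase _ (fun j => μ j (Function.update s i Set.univ j)) (Finset.mem_univ i),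
    ← Finset.mul_prod_erase _ (fun j => μ j (s j)) (Finset.mem_univ i)]
  simp only [Function.update_self, measure_univ, one_mul]
  rw [mul_comm]
  congr 1
  refine Finset.prod_congr rfl fun j hj => ?_
  rw [Function.update_of_ne (Finset.ne_of_mem_erase hj)]

/-- Redrawing one coordinate leaves the product law unchanged, so it is enough to bound each
one-dimensional section. -/
theorem lintegral_pi_le_of_update {ι : Type*} [Fintype ι] [DecidableEq ι] {α : ι → Type*}
    [∀ i, MeasurableSpace (α i)] (μ : ∀ i, Measure (α i)) [∀ i, IsProbabilityMeasure (μ i)]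
    (i : ι) {F : (∀ j, α j) → ℝ≥0∞} (hF : Measurable F) {G : (∀ j, α j) → ℝ≥0∞}
    (h : ∀ x, ∫⁻ t, F (Function.update x i t) ∂(μ i) ≤ G x) :
    ∫⁻ x, F x ∂(Measure.pi μ) ≤ ∫⁻ x, G x ∂(Measure.pi μ) := by
  have hp := measurePreserving_update μ i
  rw [← hp.lintegral_comp hF, lintegral_prod]
  · exact lintegral_mono h
  · exact (hF.comp hp.measurable).aemeasurable

theorem lintegral_pi_prod {ι : Type*} [Fintype ι] {α : ι → Type*} [∀ i, MeasurableSpace (α i)]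
    {μ : ∀ i, Measure (α i)} [∀ i, IsProbabilityMeasure (μ i)] {f : ∀ i, α i → ℝ≥0∞}
    (hf : ∀ i, Measurable (f i)) :
    ∫⁻ x, ∏ i, f i (x i) ∂(Measure.pi μ) = ∏ i, ∫⁻ y, f i y ∂(μ i) := by
  have h := lintegral_prod_eq_prod_lintegral_of_indepFun (μ := Measure.pi μ) Finset.univ
    (fun i (x : ∀ i, α i) => f i (x i)) (iIndepFun_pi fun i => (hf i).aemeasurable)
    fun i => (hf i).comp (measurable_pi_apply i)
  rw [h]
  exact Finset.prod_congr rfl fun i _ => (measurePreserving_eval μ i).lintegral_comp (hf i)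

/-! ### Measures with a log-density bounded in mean -/

/-- `μ` has density `exp (-w)` with respect to `ρ`, and the mean of `w` under `ρ` is at most `K`;
thus the Kullback-Leibler divergence of `ρ` from `μ` is at most `K`. -/
def LogDensityBound {α : Type*} [MeasurableSpace α] (μ ρ : Measure α) (K : ℝ) : Prop :=
  ∃ w : α → ℝ, Measurable w ∧ μ = ρ.withDensity (fun x => ENNReal.ofReal (Real.exp (-w x))) ∧
    Integrable w ρ ∧ ∫ x, w x ∂ρ ≤ K

theorem LogDensityBound.refl {α : Type*} [MeasurableSpace α] (μ : Measure α) :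
    LogDensityBound μ μ 0 :=
  ⟨fun _ => 0, measurable_const, by simp, integrable_zero _ _ _, by simp⟩

theorem LogDensityBound.mono {α : Type*} [MeasurableSpace α] {μ ρ : Measure α} {K K' : ℝ}
    (h : LogDensityBound μ ρ K) (hK : K ≤ K') : LogDensityBound μ ρ K' := by
  obtain ⟨w, h1, h2, h3, h4⟩ := h
  exact ⟨w, h1, h2, h3, h4.trans hK⟩

theorem LogDensityBound.prod {α β : Type*} [MeasurableSpace α] [MeasurableSpace β]
    {μ ρ : Measure α} {μ' ρ' : Measure β} [IsProbabilityMeasure ρ] [IsProbabilityMeasure ρ']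
    {K K' : ℝ} (h : LogDensityBound μ ρ K) (h' : LogDensityBound μ' ρ' K') :
    LogDensityBound (μ.prod μ') (ρ.prod ρ') (K + K') := by
  obtain ⟨w, h1, h2, h3, h4⟩ := h
  obtain ⟨w', h1', h2', h3', h4'⟩ := h'
  refine ⟨fun z => w z.1 + w' z.2, by fun_prop, ?_, (h3.comp_fst _).add (h3'.comp_snd _), ?_⟩
  · rw [h2, h2', prod_withDensity (by fun_prop) (by fun_prop)]
    congr 1
    ext z
    rw [neg_add, Real.exp_add, ENNReal.ofReal_mul (Real.exp_nonneg _)]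
  · rw [integral_add (h3.comp_fst _) (h3'.comp_snd _), integral_fun_fst, integral_fun_snd]
    simpa using add_le_add h4 h4'

theorem LogDensityBound.pi {ι : Type*} [Fintype ι] {α : ι → Type*} [∀ i, MeasurableSpace (α i)]
    {μ ρ : ∀ i, Measure (α i)} [∀ i, IsProbabilityMeasure (μ i)]
    [∀ i, IsProbabilityMeasure (ρ i)] {K : ι → ℝ}
    (h : ∀ i, LogDensityBound (μ i) (ρ i) (K i)) :
    LogDensityBound (Measure.pi μ) (Measure.pi ρ) (∑ i, K i) := by
  choose w h1 h2 h3 h4 using h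
  have hi : ∀ i, Integrable (fun x : ∀ i, α i => w i (x i)) (Measure.pi ρ) := fun i =>
    ((measurePreserving_eval ρ i).integrable_comp (h3 i).aestronglyMeasurable).2 (h3 i)
  refine ⟨fun x => ∑ i, w i (x i), by fun_prop, ?_, integrable_finsetSum _ fun i _ => hi i, ?_⟩
  · refine Measure.pi_eq fun s hs => ?_
    rw [withDensity_apply _ (MeasurableSet.univ_pi hs),
      ← lintegral_indicator (MeasurableSet.univ_pi hs)]
    have : (Set.univ.pi s).indicator
        (fun x : ∀ i, α i => ENNReal.ofReal (Real.exp (-∑ i, w i (x i))))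
        = fun x => ∏ i, (s i).indicator (fun y => ENNReal.ofReal (Real.exp (-w i y))) (x i) := by
      ext x
      by_cases hx : x ∈ Set.univ.pi s
      · rw [Set.indicator_of_mem hx, ← Finset.sum_neg_distrib, Real.exp_sum,
          ENNReal.ofReal_prod_of_nonneg fun i _ => Real.exp_nonneg _]
        exact Finset.prod_congr rfl fun i _ => by
          rw [Set.indicator_of_mem (hx i (Set.mem_univ i))]
      · rw [Set.indicator_of_notMem hx]
        simp only [Set.mem_pi, Set.mem_univ, true_implies, not_forall] at hx
        obtain ⟨i, hi⟩ := hx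
        exact (Finset.prod_eq_zero (Finset.mem_univ i) (Set.indicator_of_notMem hi _)).symm
    rw [this, lintegral_pi_prod fun i => Measurable.indicator (by have := h1 i; fun_prop) (hs i)]
    refine Finset.prod_congr rfl fun i _ => ?_
    rw [lintegral_indicator (hs i), h2 i, withDensity_apply _ (hs i)]
  · rw [integral_finsetSum _ fun i _ => hi i]
    refine Finset.sum_le_sum fun i _ => ?_
    rw [integral_comp_eval (h3 i).aestronglyMeasurable]
    exact h4 i

/-- The easy half of the Donsker-Varadhan variational formula. -/
theorem LogDensityBound.exp_le_lintegral {α : Type*} [MeasurableSpace α] {μ ρ : Measure α}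
    [IsProbabilityMeasure ρ] {K : ℝ} (h : LogDensityBound μ ρ K) {r : α → ℝ} (hr : Measurable r)
    (hri : Integrable r ρ) :
    ENNReal.ofReal (Real.exp (-∫ x, r x ∂ρ - K)) ≤
      ∫⁻ x, ENNReal.ofReal (Real.exp (-r x)) ∂μ := by
  obtain ⟨w, h1, h2, h3, h4⟩ := h
  set c := ∫ x, (r x + w x) ∂ρ with hc
  have hcK : -∫ x, r x ∂ρ - K ≤ -c := by
    rw [hc, integral_add hri h3]; linarith
  -- Tangent line of `exp` at `-c`: it lies below `exp (-(r + w))` and its `ρ`-mean is exactly `exp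
  -- (-c)`. Being affine in `r + w`, it is integrable without any assumption on `exp (-r)`.
  have hint : Integrable (fun x => Real.exp (-c) * (1 - ((r x + w x) - c))) ρ :=
    (((integrable_const (1 : ℝ)).sub ((hri.add h3).sub (integrable_const c)))).const_mul _
  have hval : ∫ x, Real.exp (-c) * (1 - ((r x + w x) - c)) ∂ρ = Real.exp (-c) := by
    have hu : Integrable (fun x => r x + w x) ρ := hri.add h3
    have hu' : Integrable (fun x => r x + w x - c) ρ := hu.sub (integrable_const c)
    have e1 : ∫ x, ((r x + w x) - c) ∂ρ = 0 := by
      rw [integral_sub hu (integrable_const c)]; simp [← hc]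
    have e2 : ∫ x, (1 - ((r x + w x) - c)) ∂ρ = 1 := by
      rw [integral_sub (integrable_const _) hu', e1]; simp
    rw [integral_const_mul, e2, mul_one]
  rw [h2, lintegral_withDensity_eq_lintegral_mul _ (by fun_prop) (by fun_prop)]
  calc ENNReal.ofReal (Real.exp (-∫ x, r x ∂ρ - K))
      ≤ ENNReal.ofReal (Real.exp (-c)) :=
        ENNReal.ofReal_le_ofReal (Real.exp_le_exp.2 hcK)
    _ = ENNReal.ofReal (∫ x, Real.exp (-c) * (1 - ((r x + w x) - c)) ∂ρ) := by rw [hval]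
    _ ≤ ENNReal.ofReal (∫ x, max (Real.exp (-c) * (1 - ((r x + w x) - c))) 0 ∂ρ) :=
        ENNReal.ofReal_le_ofReal (integral_mono hint hint.pos_part fun x => le_max_left _ _)
    _ = ∫⁻ x, ENNReal.ofReal (max (Real.exp (-c) * (1 - ((r x + w x) - c))) 0) ∂ρ :=
        ofReal_integral_eq_lintegral_ofReal hint.pos_part
          (Filter.Eventually.of_forall fun x => le_max_right _ _)
    _ ≤ _ := by
        refine lintegral_mono fun x => ?_
        simp only [Pi.mul_apply]
        rw [← ENNReal.ofReal_mul (Real.exp_nonneg _), ← Real.exp_add]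
        refine ENNReal.ofReal_le_ofReal (max_le ?_ (Real.exp_nonneg _))
        have e : -w x + -r x = -c + (c - (r x + w x)) := by ring
        rw [e, Real.exp_add (-c)]
        gcongr
        linarith [Real.add_one_le_exp (c - (r x + w x))]

/-- The mean of a potential under its Gibbs measure is at most minus the log-partition function. -/
theorem integral_tilted_neg_le {α : Type*} [MeasurableSpace α] {μ : Measure α}
    [IsProbabilityMeasure μ] {r : α → ℝ} (hr : Integrable (fun x => Real.exp (-r x)) μ)
    (hri : Integrable r (μ.tilted fun x => -r x)) :
    ∫ x, r x ∂(μ.tilted fun x => -r x) ≤ -Real.log (∫ x, Real.exp (-r x) ∂μ) := by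
  set Z := ∫ x, Real.exp (-r x) ∂μ with hZ
  have hZpos : 0 < Z := integral_exp_pos hr
  rw [integral_tilted]
  have hri' : Integrable (fun x => Real.exp (-r x) • r x) μ := by
    rw [integrable_tilted_iff hr] at hri; exact hri
  have h1 : ∫ x, (Real.exp (-r x) / Z) • r x ∂μ = Z⁻¹ * ∫ x, Real.exp (-r x) • r x ∂μ := by
    rw [← integral_const_mul]; congr 1; ext x; simp only [smul_eq_mul]; ring
  rw [h1]
  -- This is `1 + u ≤ exp u` at `u = r x + log Z`, times `exp (-r x)`. Integrated, it says that the
  -- relative entropy of the Gibbs measure with respect to `μ` is nonnegative.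
  have key : ∀ x, Real.exp (-r x) • r x ≤
      Z - Real.exp (-r x) * (1 + Real.log Z) := by
    intro x
    have h2 := Real.add_one_le_exp (r x + Real.log Z)
    rw [Real.exp_add, Real.exp_log hZpos] at h2
    have h3 : Real.exp (-r x) * (r x + Real.log Z + 1) ≤
        Real.exp (-r x) * (Real.exp (r x) * Z) := by gcongr
    rw [← mul_assoc, ← Real.exp_add] at h3
    simp only [neg_add_cancel, Real.exp_zero] at h3
    simp only [smul_eq_mul]; linarith
  have h4 : _ ≤ ∫ x, (Z - Real.exp (-r x) * (1 + Real.log Z)) ∂μ :=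
    integral_mono hri' ((integrable_const _).sub (hr.mul_const _)) key
  rw [integral_sub (integrable_const _) (hr.mul_const _), integral_mul_const, ← hZ] at h4
  simp only [integral_const, probReal_univ, smul_eq_mul, one_mul] at h4
  calc Z⁻¹ * ∫ x, Real.exp (-r x) • r x ∂μ
      ≤ Z⁻¹ * (Z - Z * (1 + Real.log Z)) := by gcongr; simpa using h4
    _ = -Real.log Z := by field_simp; ring

/-! ### Exponential weighting for a general regression model -/

/-- The Gibbs measure of the quadratic loss `∑ i, (y i - φ i θ) ^ 2`. -/
noncomputable def gibbs {Θ ι : Type*} [MeasurableSpace Θ] [Fintype ι] (μ : Measure Θ)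
    (φ : ι → Θ → ℝ) (lam : ℝ) (y : ι → ℝ) : Measure Θ :=
  μ.tilted fun θ => -lam * ∑ i, (y i - φ i θ) ^ 2

/-- A centered square-integrable law with a Stein-type inequality for nondecreasing functions. -/
structure SteinBound (ν : Measure ℝ) (c : ℝ) : Prop where
  memLp : MemLp id 2 ν
  centered : ∫ x, x ∂ν = 0
  le : ∀ g g' : ℝ → ℝ, (∀ t, HasDerivAt g (g' t) t) → (∀ t, 0 ≤ g' t) → Integrable g ν →
    Integrable (fun t => t * g t) ν → Integrable g' ν → ∫ t, t * g t ∂ν ≤ c * ∫ t, g' t ∂ν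

section

variable {Θ ι : Type*} [MeasurableSpace Θ] [Fintype ι] {μ : Measure Θ} [IsProbabilityMeasure μ]
  {φ : ι → Θ → ℝ} {lam : ℝ}

theorem integrable_exp_neg_loss (hφ : ∀ i, Measurable (φ i)) (hlam : 0 < lam) (y : ι → ℝ) :
    Integrable (fun θ => Real.exp (-lam * ∑ i, (y i - φ i θ) ^ 2)) μ := by
  refine Integrable.of_bound (C := 1) (Measurable.aestronglyMeasurable (by fun_prop))
    (Filter.Eventually.of_forall fun θ => ?_)
  rw [Real.norm_eq_abs, abs_of_pos (Real.exp_pos _), Real.exp_le_one_iff]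
  have : 0 ≤ ∑ i, (y i - φ i θ) ^ 2 := Finset.sum_nonneg fun i _ => sq_nonneg _
  nlinarith

theorem isProbabilityMeasure_gibbs (hφ : ∀ i, Measurable (φ i)) (hlam : 0 < lam) (y : ι → ℝ) :
    IsProbabilityMeasure (gibbs μ φ lam y) :=
  isProbabilityMeasure_tilted (integrable_exp_neg_loss hφ hlam y)

/-- Completing the square: the quadratic loss beats any linear exponent in `φ i`. Hence `φ i` has
all moments under the Gibbs measure, whatever its tails under `μ`. -/
theorem integrable_exp_mul_gibbs (hφ : ∀ i, Measurable (φ i)) (hlam : 0 < lam) (y : ι → ℝ)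
    (i : ι) (t : ℝ) : Integrable (fun θ => Real.exp (t * φ i θ)) (gibbs μ φ lam y) := by
  rw [gibbs, integrable_tilted_iff (integrable_exp_neg_loss hφ hlam y)]
  refine Integrable.of_bound (C := Real.exp (t * y i + t ^ 2 / (4 * lam)))
    (Measurable.aestronglyMeasurable (by fun_prop)) (Filter.Eventually.of_forall fun θ => ?_)
  rw [smul_eq_mul, ← Real.exp_add, Real.norm_eq_abs, abs_of_pos (Real.exp_pos _),
    Real.exp_le_exp]
  have h1 : (y i - φ i θ) ^ 2 ≤ ∑ j, (y j - φ j θ) ^ 2 :=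
    Finset.single_le_sum (f := fun j => (y j - φ j θ) ^ 2) (fun j _ => sq_nonneg _)
      (Finset.mem_univ i)
  have h2 : t * y i + t ^ 2 / (4 * lam) - (-lam * (y i - φ i θ) ^ 2 + t * φ i θ)
      = lam * (y i - φ i θ + t / (2 * lam)) ^ 2 := by field_simp; ring
  have h3 : 0 ≤ lam * (y i - φ i θ + t / (2 * lam)) ^ 2 := by positivity
  nlinarith

theorem mem_interior_integrableExpSet_gibbs (hφ : ∀ i, Measurable (φ i)) (hlam : 0 < lam)
    (y : ι → ℝ) (i : ι) (t : ℝ) :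
    t ∈ interior (integrableExpSet (φ i) (gibbs μ φ lam y)) := by
  have : integrableExpSet (φ i) (gibbs μ φ lam y) = Set.univ :=
    Set.eq_univ_of_forall fun t => integrable_exp_mul_gibbs hφ hlam y i t
  simp [this]

theorem memLp_gibbs (hφ : ∀ i, Measurable (φ i)) (hlam : 0 < lam) (y : ι → ℝ) (i : ι) (q : ℝ≥0) :
    MemLp (φ i) q (gibbs μ φ lam y) :=
  memLp_of_mem_interior_integrableExpSet (mem_interior_integrableExpSet_gibbs hφ hlam y i 0) q

/-- Only the `i`-th square involves `t`. Its cross term `2 * lam * t * φ i` is a linear tilt, and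
`lam * t ^ 2` is constant in `θ` and cancels in the normalization. -/
theorem gibbs_update [DecidableEq ι] (hφ : ∀ i, Measurable (φ i)) (hlam : 0 < lam) (y : ι → ℝ)
    (i : ι) (t : ℝ) :
    gibbs μ φ lam (Function.update y i t) =
      (gibbs μ φ lam (Function.update y i 0)).tilted (fun θ => (2 * lam * t) * φ i θ) := by
  have hc : ∀ (f : Θ → ℝ) (c : ℝ), μ.tilted (fun θ => f θ + c) = μ.tilted f := by
    intro f c
    simp only [Measure.tilted, Real.exp_add, integral_mul_const]
    congr 1
    ext θ
    rw [mul_div_mul_right _ _ (Real.exp_ne_zero c)]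
  rw [gibbs, gibbs, tilted_tilted (integrable_exp_neg_loss hφ hlam _),
    ← hc _ (lam * t ^ 2)]
  congr 1
  ext θ
  simp only [Pi.add_apply]
  rw [← Finset.add_sum_erase _ (fun j => (Function.update y i 0 j - φ j θ) ^ 2) (Finset.mem_univ i),
    ← Finset.add_sum_erase _ (fun j => (Function.update y i t j - φ j θ) ^ 2) (Finset.mem_univ i)]
  have : ∀ s : ℝ, ∑ j ∈ Finset.univ.erase i, (Function.update y i s j - φ j θ) ^ 2
      = ∑ j ∈ Finset.univ.erase i, (y j - φ j θ) ^ 2 := fun s =>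
    Finset.sum_congr rfl fun j hj => by rw [Function.update_of_ne (Finset.ne_of_mem_erase hj)]
  rw [this, this]
  simp only [Function.update_self]
  ring

/-- In an exponential family the mean and the variance are the first two derivatives of the cumulant
generating function; the chain rule through `2 * lam * t` supplies the factor. -/
theorem hasDerivAt_integral_gibbs [DecidableEq ι] (hφ : ∀ i, Measurable (φ i)) (hlam : 0 < lam)
    (y : ι → ℝ) (i : ι) (t : ℝ) :
    HasDerivAt (fun t => ∫ θ, φ i θ ∂(gibbs μ φ lam (Function.update y i t)))
      (2 * lam * Var[φ i; gibbs μ φ lam (Function.update y i t)]) t := by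
  have hI := mem_interior_integrableExpSet_gibbs (μ := μ) hφ hlam (Function.update y i 0) i
  have h1 : (fun t => ∫ θ, φ i θ ∂(gibbs μ φ lam (Function.update y i t)))
      = fun t => deriv (cgf (φ i) (gibbs μ φ lam (Function.update y i 0))) (2 * lam * t) := by
    ext t
    rw [gibbs_update hφ hlam, integral_tilted_mul_self (hI _)]
  rw [h1, gibbs_update hφ hlam y i t, variance_tilted_mul (hI _), iteratedDeriv_succ,
    iteratedDeriv_one]
  have h2 := ((analyticAt_cgf (hI (2 * lam * t))).deriv.differentiableAt).hasDerivAt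
  have h3 : HasDerivAt (fun t : ℝ => 2 * lam * t) (2 * lam) t := by
    simpa using (hasDerivAt_id t).const_mul (2 * lam)
  rw [mul_comm (2 * lam)]
  exact h2.comp t h3

/-- Bias-variance decomposition in each coordinate. It puts into the loss the same variances that
appear as derivatives in Stein's inequality. -/
theorem integral_loss_gibbs (hφ : ∀ i, Measurable (φ i)) (hlam : 0 < lam) (y : ι → ℝ) :
    ∫ θ, ∑ i, (y i - φ i θ) ^ 2 ∂(gibbs μ φ lam y) =
      ∑ i, ((y i - ∫ θ, φ i θ ∂(gibbs μ φ lam y)) ^ 2 + Var[φ i; gibbs μ φ lam y]) := by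
  have := isProbabilityMeasure_gibbs (μ := μ) hφ hlam y
  have hL : ∀ i, MemLp (φ i) 2 (gibbs μ φ lam y) := fun i => memLp_gibbs hφ hlam y i 2
  have hL' : ∀ i, MemLp (fun θ => y i - φ i θ) 2 (gibbs μ φ lam y) := fun i =>
    (memLp_const _).sub (hL i)
  rw [integral_finsetSum _ fun i _ => (hL' i).integrable_sq]
  refine Finset.sum_congr rfl fun i _ => ?_
  have h1 := variance_eq_sub (hL' i)
  rw [variance_const_sub (hL i).aestronglyMeasurable,
    integral_sub (integrable_const _) ((hL i).integrable (by norm_num))] at h1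
  simp only [Pi.pow_apply, integral_const, probReal_univ, smul_eq_mul, one_mul] at h1
  rw [h1]; ring

theorem integrable_loss_gibbs (hφ : ∀ i, Measurable (φ i)) (hlam : 0 < lam) (y : ι → ℝ) :
    Integrable (fun θ => ∑ i, (y i - φ i θ) ^ 2) (gibbs μ φ lam y) := by
  have := isProbabilityMeasure_gibbs (μ := μ) hφ hlam y
  exact integrable_finsetSum _ fun i _ =>
    ((memLp_const (y i)).sub (memLp_gibbs hφ hlam y i 2)).integrable_sq

theorem measurable_integral_gibbs (hφ : ∀ i, Measurable (φ i)) {g : Θ → ℝ} (hg : Measurable g) :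
    Measurable fun y : ι → ℝ => ∫ θ, g θ ∂(gibbs μ φ lam y) := by
  simp only [gibbs, integral_tilted]
  have hZ : Measurable fun y : ι → ℝ => ∫ θ, Real.exp (-lam * ∑ i, (y i - φ i θ) ^ 2) ∂μ := by
    have : StronglyMeasurable (Function.uncurry fun (y : ι → ℝ) (θ : Θ) =>
        Real.exp (-lam * ∑ i, (y i - φ i θ) ^ 2)) := by
      refine Measurable.stronglyMeasurable ?_
      simp only [Function.uncurry_def]
      fun_prop
    exact this.integral_prod_right.measurable
  have : StronglyMeasurable (Function.uncurry fun (y : ι → ℝ) (θ : Θ) =>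
      (Real.exp (-lam * ∑ i, (y i - φ i θ) ^ 2) /
        ∫ θ, Real.exp (-lam * ∑ i, (y i - φ i θ) ^ 2) ∂μ) • g θ) := by
    refine Measurable.stronglyMeasurable ?_
    simp only [Function.uncurry_def, smul_eq_mul]
    exact ((by fun_prop : Measurable fun z : (ι → ℝ) × Θ =>
      Real.exp (-lam * ∑ i, (z.1 i - φ i z.2) ^ 2)).div (hZ.comp measurable_fst)).mul
      (hg.comp measurable_snd)
  exact this.integral_prod_right.measurable

theorem measurable_variance_gibbs (hφ : ∀ i, Measurable (φ i)) (hlam : 0 < lam) (i : ι) :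
    Measurable fun y : ι → ℝ => Var[φ i; gibbs μ φ lam y] := by
  have : (fun y : ι → ℝ => Var[φ i; gibbs μ φ lam y]) = fun y =>
      (∫ θ, φ i θ ^ 2 ∂(gibbs μ φ lam y)) - (∫ θ, φ i θ ∂(gibbs μ φ lam y)) ^ 2 := by
    ext y
    have := isProbabilityMeasure_gibbs (μ := μ) hφ hlam y
    rw [variance_eq_sub (memLp_gibbs hφ hlam y i 2)]
    rfl
  rw [this]
  exact (measurable_integral_gibbs hφ ((hφ i).pow_const 2)).sub
    ((measurable_integral_gibbs hφ (hφ i)).pow_const 2)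

/-- The Stein-type inequality, one coordinate at a time, for a function of i.i.d. variables. -/
theorem SteinBound.integral_pi_le [DecidableEq ι] {ν : Measure ℝ} [IsProbabilityMeasure ν] {c : ℝ}
    (hν : SteinBound ν c) (i : ι) {F F' : (ι → ℝ) → ℝ}
    (hd : ∀ x t, HasDerivAt (fun t => F (Function.update x i t)) (F' (Function.update x i t)) t)
    (h0 : ∀ x, 0 ≤ F' x) (hF : Integrable F (Measure.pi fun _ => ν))
    (hxF : Integrable (fun x => x i * F x) (Measure.pi fun _ => ν))
    (hF' : Integrable F' (Measure.pi fun _ => ν)) :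
    ∫ x, x i * F x ∂(Measure.pi fun _ => ν) ≤ c * ∫ x, F' x ∂(Measure.pi fun _ => ν) := by
  have hp := measurePreserving_update (fun _ : ι => ν) i
  have hint : ∀ {H : (ι → ℝ) → ℝ}, Integrable H (Measure.pi fun _ => ν) →
      Integrable (fun z : (ι → ℝ) × ℝ => H (Function.update z.1 i z.2))
        ((Measure.pi fun _ => ν).prod ν) := fun {H} hH =>
    (hp.integrable_comp hH.aestronglyMeasurable).2 hH
  have hval : ∀ {H : (ι → ℝ) → ℝ}, Integrable H (Measure.pi fun _ => ν) →
      ∫ x, H x ∂(Measure.pi fun _ => ν) =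
        ∫ x, ∫ t, H (Function.update x i t) ∂ν ∂(Measure.pi fun _ => ν) := by
    intro H hH
    rw [← integral_prod _ (hint hH)]
    conv_lhs => rw [← hp.map_eq]
    rw [integral_map hp.measurable.aemeasurable]
    rw [hp.map_eq]; exact hH.aestronglyMeasurable
  rw [hval hxF, hval hF', ← integral_const_mul]
  refine integral_mono_ae (hint hxF).integral_prod_left
    ((hint hF').integral_prod_left.const_mul c) ?_
  filter_upwards [(hint hF).prod_right_ae, (hint hxF).prod_right_ae, (hint hF').prod_right_ae]
    with x h1 h2 h3
  simp only [Function.update_self] at h2 ⊢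
  exact hν.le _ _ (hd x) (fun t => h0 _) h1 h2 h3

theorem SteinBound.memLp_eval {ν : Measure ℝ} [IsProbabilityMeasure ν] {c : ℝ}
    (hν : SteinBound ν c) (i : ι) :
    MemLp (fun x : ι → ℝ => x i) 2 (Measure.pi fun _ => ν) :=
  hν.memLp.comp_measurePreserving (measurePreserving_eval (fun _ : ι => ν) i)

theorem SteinBound.integral_eval {ν : Measure ℝ} [IsProbabilityMeasure ν] {c : ℝ}
    (hν : SteinBound ν c) (i : ι) : ∫ x : ι → ℝ, x i ∂(Measure.pi fun _ => ν) = 0 := by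
  have h := integral_comp_eval (μ := fun _ : ι => ν) (i := i) (f := fun t : ℝ => t)
    measurable_id.aestronglyMeasurable
  exact h.trans hν.centered

/-- Risk bound for a vector `m` of functions of i.i.d. noise with nonnegative partial derivatives
`2 * lam * V i`, given a bound for `∑ i, ((f i + x i - m i x) ^ 2 + V i x)`. -/
theorem SteinBound.risk_le {ν : Measure ℝ} [IsProbabilityMeasure ν] {c : ℝ}
    (hν : SteinBound ν c) (hlam : 0 < lam) (hc : 4 * lam * c ≤ 1) [DecidableEq ι]
    (f : ι → ℝ) {m V : ι → (ι → ℝ) → ℝ} (hmm : ∀ i, Measurable (m i))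
    (hVm : ∀ i, Measurable (V i)) (hV0 : ∀ i x, 0 ≤ V i x)
    (hd : ∀ i x t, HasDerivAt (fun t => m i (Function.update x i t))
      (2 * lam * V i (Function.update x i t)) t)
    {f0 : ι → ℝ} {C : ℝ}
    (hbd : ∀ x, ∑ i, ((f i + x i - m i x) ^ 2 + V i x) ≤ ∑ i, (f i + x i - f0 i) ^ 2 + C) :
    Integrable (fun x => ∑ i, (m i x - f i) ^ 2) (Measure.pi fun _ => ν) ∧
    ∫ x, ∑ i, (m i x - f i) ^ 2 ∂(Measure.pi fun _ => ν) ≤ ∑ i, (f i - f0 i) ^ 2 + C := by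
  generalize hξ : (Measure.pi fun _ : ι => ν) = ξ
  have hprob : IsProbabilityMeasure ξ := by rw [← hξ]; infer_instance
  have hx2 : ∀ i, MemLp (fun x : ι → ℝ => x i) 2 ξ := fun i => by
    rw [← hξ]; exact hν.memLp_eval i
  have hx0 : ∀ i, ∫ x, x i ∂ξ = 0 := fun i => by
    rw [← hξ]; exact hν.integral_eval i
  have hres2 : ∀ i, MemLp (fun x : ι → ℝ => f i + x i - f0 i) 2 ξ := fun i =>
    ((memLp_const (f i)).add (hx2 i)).sub (memLp_const (f0 i))
  -- The right side of `hbd` needs only second moments of the noise, and it dominates both the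
  -- squared residuals and the `V i`; all integrability below comes from it.
  have hdom : Integrable (fun x => ∑ i, (f i + x i - f0 i) ^ 2 + C) ξ :=
    (integrable_finsetSum _ fun i _ => (hres2 i).integrable_sq).add (integrable_const _)
  have hterm : ∀ i x, (f i + x i - m i x) ^ 2 + V i x ≤ ∑ i, (f i + x i - f0 i) ^ 2 + C :=
    fun i x => (Finset.single_le_sum (f := fun i => (f i + x i - m i x) ^ 2 + V i x)
      (fun j _ => add_nonneg (sq_nonneg _) (hV0 j x)) (Finset.mem_univ i)).trans (hbd x)
  have hVi : ∀ i, Integrable (V i) ξ := fun i =>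
    hdom.mono' (hVm i).aestronglyMeasurable (Filter.Eventually.of_forall fun x => by
      rw [Real.norm_eq_abs, abs_of_nonneg (hV0 i x)]
      linarith [hterm i x, sq_nonneg (f i + x i - m i x)])
  have hrm : ∀ i, Measurable fun x : ι → ℝ => f i + x i - m i x := fun i =>
    (measurable_const.add (measurable_pi_apply i)).sub (hmm i)
  have hri : ∀ i, Integrable (fun x => (f i + x i - m i x) ^ 2) ξ := fun i =>
    hdom.mono' ((hrm i).pow_const 2).aestronglyMeasurable
      (Filter.Eventually.of_forall fun x => by
        rw [Real.norm_eq_abs, abs_of_nonneg (sq_nonneg _)]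
        linarith [hterm i x, hV0 i x])
  have hr2 : ∀ i, MemLp (fun x => f i + x i - m i x) 2 ξ := fun i =>
    (memLp_two_iff_integrable_sq (hrm i).aestronglyMeasurable).2 (hri i)
  have hm2 : ∀ i, MemLp (m i) 2 ξ := fun i => by
    have : m i = fun x => (f i + x i) - (f i + x i - m i x) := by ext x; ring
    rw [this]
    exact ((memLp_const (f i)).add (hx2 i)).sub (hr2 i)
  have hxm : ∀ i, Integrable (fun x => x i * m i x) ξ := fun i => (hx2 i).integrable_mul (hm2 i)
  have hstein : ∀ i, ∫ x, x i * m i x ∂ξ ≤ c * ∫ x, 2 * lam * V i x ∂ξ := fun i => by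
    subst hξ
    exact hν.integral_pi_le i (F := m i) (F' := fun x => 2 * lam * V i x) (hd i)
      (fun x => mul_nonneg (by positivity) (hV0 i x))
      ((hm2 i).integrable (by norm_num)) (hxm i) ((hVi i).const_mul _)
  have hmi : Integrable (fun x => ∑ i, (m i x - f i) ^ 2) ξ := integrable_finsetSum _ fun i _ =>
    ((hm2 i).sub (memLp_const (f i))).integrable_sq
  refine ⟨hmi, ?_⟩
  have hxi : ∀ i, Integrable (fun x : ι → ℝ => x i) ξ := fun i => (hx2 i).integrable (by norm_num)
  have hpt : ∀ x, ∑ i, (m i x - f i) ^ 2 ≤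
      C + ∑ i, ((f i - f0 i) ^ 2 + (2 * (x i * m i x) - V i x - 2 * f0 i * x i)) := fun x => by
    -- Expansion around the residual, arranged so that `hbd` applies. The comparison vector then
    -- meets the noise only in a linear term, whose mean is zero.
    have h1 : ∀ i, (m i x - f i) ^ 2 = ((f i + x i - m i x) ^ 2 + V i x) -
        (f i + x i - f0 i) ^ 2 + ((f i - f0 i) ^ 2 +
          (2 * (x i * m i x) - V i x - 2 * f0 i * x i)) := fun i => by ring
    rw [Finset.sum_congr rfl fun i _ => h1 i, Finset.sum_add_distrib, Finset.sum_sub_distrib]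
    linarith [hbd x]
  have e0 : ∀ i, Integrable (fun x : ι → ℝ => 2 * (x i * m i x) - V i x) ξ := fun i =>
    ((hxm i).const_mul 2).sub (hVi i)
  have e1 : ∀ i, Integrable (fun x : ι → ℝ => 2 * (x i * m i x) - V i x - 2 * f0 i * x i) ξ :=
    fun i => (e0 i).sub ((hxi i).const_mul _)
  have hti : ∀ i, Integrable (fun x : ι → ℝ => (f i - f0 i) ^ 2 +
      (2 * (x i * m i x) - V i x - 2 * f0 i * x i)) ξ := fun i =>
    (integrable_const _).add (e1 i)
  have htv : ∀ i, ∫ x, ((f i - f0 i) ^ 2 + (2 * (x i * m i x) - V i x - 2 * f0 i * x i)) ∂ξ ≤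
      (f i - f0 i) ^ 2 := fun i => by
    rw [integral_add (integrable_const _) (e1 i),
      integral_sub (e0 i) ((hxi i).const_mul _), integral_sub ((hxm i).const_mul 2) (hVi i),
      integral_const_mul, integral_const_mul, hx0]
    have h2 := hstein i
    rw [integral_const_mul] at h2
    have h3 : 0 ≤ ∫ x, V i x ∂ξ := integral_nonneg (hV0 i)
    -- Stein gives `2 𝔼[x i * m i] ≤ 4 * lam * c * 𝔼[V i]`, so `4 * lam * c ≤ 1` lets `-V i` cancel
    -- it.
    have h4 := mul_le_mul_of_nonneg_right hc h3
    simp only [integral_const, probReal_univ, smul_eq_mul, one_mul, mul_zero, sub_zero]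
    linarith
  have hsum := integrable_finsetSum Finset.univ fun i _ => hti i
  calc ∫ x, ∑ i, (m i x - f i) ^ 2 ∂ξ
      ≤ ∫ x, (C + ∑ i, ((f i - f0 i) ^ 2 +
          (2 * (x i * m i x) - V i x - 2 * f0 i * x i))) ∂ξ :=
        integral_mono hmi ((integrable_const _).add hsum) hpt
    _ = C + ∑ i, ∫ x, ((f i - f0 i) ^ 2 +
          (2 * (x i * m i x) - V i x - 2 * f0 i * x i)) ∂ξ := by
        rw [integral_add (integrable_const _) hsum, integral_finsetSum _ fun i _ => hti i]
        simp
    _ ≤ ∑ i, (f i - f0 i) ^ 2 + C := by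
        rw [add_comm]
        exact add_le_add (Finset.sum_le_sum fun i _ => htv i) le_rfl

/-- Oracle inequality for the exponentially weighted aggregate: a bound for the mean empirical
loss under the Gibbs measures turns into a bound for the risk of their means. -/
theorem oracle_inequality (hφ : ∀ i, Measurable (φ i)) (hlam : 0 < lam) {ν : Measure ℝ}
    [IsProbabilityMeasure ν] {c : ℝ} (hν : SteinBound ν c) (hc : 4 * lam * c ≤ 1)
    (f : ι → ℝ) {f0 : ι → ℝ} {C : ℝ}
    (hC : ∀ y, ∫ θ, ∑ i, (y i - φ i θ) ^ 2 ∂(gibbs μ φ lam y) ≤ ∑ i, (y i - f0 i) ^ 2 + C) :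
    Integrable (fun x : ι → ℝ => ∑ i, (∫ θ, φ i θ ∂(gibbs μ φ lam (f + x)) - f i) ^ 2)
      (Measure.pi fun _ => ν) ∧
    ∫ x, ∑ i, (∫ θ, φ i θ ∂(gibbs μ φ lam (f + x)) - f i) ^ 2 ∂(Measure.pi fun _ => ν) ≤
      ∑ i, (f i - f0 i) ^ 2 + C := by
  classical
  have hadd : Measurable fun x : ι → ℝ => f + x := measurable_const.add measurable_id
  refine hν.risk_le hlam hc f (m := fun i x => ∫ θ, φ i θ ∂(gibbs μ φ lam (f + x)))
    (V := fun i x => Var[φ i; gibbs μ φ lam (f + x)])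
    (fun i => (measurable_integral_gibbs hφ (hφ i)).comp hadd)
    (fun i => (measurable_variance_gibbs hφ hlam i).comp hadd)
    (fun i x => variance_nonneg _ _) (fun i x t => ?_) (fun x => ?_)
  · have hu : ∀ s, f + Function.update x i s = Function.update (f + x) i (f i + s) := by
      intro s; ext j
      by_cases hj : j = i
      · subst hj; simp
      · simp [Function.update_of_ne hj]
    simp only [hu]
    exact (hasDerivAt_integral_gibbs hφ hlam (f + x) i (f i + t)).comp_const_add (f i) t
  · have := hC (f + x)
    rwa [integral_loss_gibbs hφ hlam] at this

end

/-! ### Noise laws satisfying the Stein-type inequality -/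

theorem SteinBound.mono {ν : Measure ℝ} {c c' : ℝ} (h : SteinBound ν c) (hc : c ≤ c') :
    SteinBound ν c' :=
  ⟨h.memLp, h.centered, fun g g' hd h0 h1 h2 h3 => (h.le g g' hd h0 h1 h2 h3).trans
    (mul_le_mul_of_nonneg_right hc (integral_nonneg h0))⟩

theorem hasDerivAt_gaussianPDFReal_zero {v : ℝ≥0} (hv : v ≠ 0) (x : ℝ) :
    HasDerivAt (gaussianPDFReal 0 v) (-(x / v) * gaussianPDFReal 0 v x) x := by
  have hv' : (v : ℝ) ≠ 0 := by exact_mod_cast hv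
  have h1 : HasDerivAt (fun x : ℝ => -(x - 0) ^ 2 / (2 * v)) (-(x / v)) x := by
    have h := ((((hasDerivAt_id x).sub_const 0).pow 2).neg).div_const (2 * (v : ℝ))
    convert! h using 1
    simp only [id, Nat.cast_ofNat]
    field_simp
    ring
  have h2 := (h1.exp).const_mul (√(2 * Real.pi * v))⁻¹
  convert! h2 using 1
  rw [gaussianPDFReal]; ring

/-- Integration by parts against the Gaussian density, with equality. For `v = 0` the law is a Dirac
mass at zero and both sides vanish. -/
theorem steinBound_gaussianReal (v : ℝ≥0) : SteinBound (gaussianReal 0 v) v := by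
  refine ⟨memLp_id_gaussianReal 2, integral_id_gaussianReal, fun g g' hd h0 h1 h2 h3 => ?_⟩
  by_cases hv : v = 0
  · simp [hv]
  have hv' : (v : ℝ) ≠ 0 := by exact_mod_cast hv
  have tr : ∀ {h : ℝ → ℝ}, Integrable h (gaussianReal 0 v) →
      Integrable (fun x => gaussianPDFReal 0 v x * h x) := by
    intro h hh
    rw [gaussianReal_of_var_ne_zero _ hv, integrable_withDensity_iff_integrable_smul₀'
      (measurable_gaussianPDF 0 v).aemeasurable
      (Filter.Eventually.of_forall fun x => gaussianPDF_lt_top)] at hh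
    simpa [toReal_gaussianPDF] using hh
  rw [integral_gaussianReal_eq_integral_smul hv, integral_gaussianReal_eq_integral_smul hv]
  have key := integral_mul_deriv_eq_deriv_mul_of_integrable (u := g) (v := gaussianPDFReal 0 v)
    (u' := g') (v' := fun x => -(x / v) * gaussianPDFReal 0 v x) (fun x _ => hd x)
    (fun x _ => hasDerivAt_gaussianPDFReal_zero hv x) ?_ ?_ ?_
  · have e1 : ∫ x, gaussianPDFReal 0 v x • (x * g x)
        = -(v : ℝ) * ∫ x, g x * (-(x / v) * gaussianPDFReal 0 v x) := by
      rw [← integral_const_mul]; congr 1; ext x; simp only [smul_eq_mul]; field_simp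
    rw [e1, key, neg_mul_neg]
    refine le_of_eq ?_
    congr 2; ext x; simp [mul_comm]
  · have := (tr h2).const_mul (-(v : ℝ)⁻¹)
    refine this.congr (Filter.Eventually.of_forall fun x => ?_)
    simp only [Pi.mul_apply]; ring
  · refine (tr h3).congr (Filter.Eventually.of_forall fun x => ?_)
    simp only [Pi.mul_apply]; ring
  · refine (tr h1).congr (Filter.Eventually.of_forall fun x => ?_)
    simp only [Pi.mul_apply]; ring

/-- As the law is centered, the midpoint of `g (-ζ)` and `g ζ` may be subtracted from `g`; a
monotone `g` differs from it by at most half of `g ζ - g (-ζ)` on the support. That increment is the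
Lebesgue integral of `g'`, which `f ≥ fmin` compares with the integral under `ν`. This is why
`SteinBound` asks only for nondecreasing functions. -/
theorem steinBound_of_density {ζ fmin : ℝ} {f : ℝ → ℝ} {ν : Measure ℝ} [IsProbabilityMeasure ν]
    (hf : Measurable f) (hfmin : 0 < fmin) (hle : ∀ x ∈ Set.Icc (-ζ) ζ, fmin ≤ f x)
    (hν : ν = (volume.restrict (Set.Icc (-ζ) ζ)).withDensity (fun x => ENNReal.ofReal (f x)))
    (h0 : ∫ x, x ∂ν = 0) : SteinBound ν ((∫ x, |x| ∂ν) / (2 * fmin)) := by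
  have hζ : -ζ ≤ ζ := by
    by_contra h
    have : ν Set.univ = 0 := by rw [hν, Set.Icc_eq_empty h]; simp
    simp at this
  have hae : ∀ᵐ x ∂ν, x ∈ Set.Icc (-ζ) ζ := by
    have : ν ≪ volume.restrict (Set.Icc (-ζ) ζ) := hν ▸ withDensity_absolutelyContinuous _ _
    exact this.ae_le (ae_restrict_mem measurableSet_Icc)
  have hL : MemLp id 2 ν := by
    refine MemLp.of_bound aestronglyMeasurable_id ζ ?_
    filter_upwards [hae] with x hx
    rw [id, Real.norm_eq_abs]; exact abs_le.2 hx
  have hi : Integrable (fun x : ℝ => x) ν := hL.integrable (by norm_num)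
  refine ⟨hL, h0, fun g g' hd hg0 h1 h2 h3 => ?_⟩
  have hmono : Monotone g := monotone_of_deriv_nonneg (fun t => (hd t).differentiableAt)
    fun t => by rw [(hd t).deriv]; exact hg0 t
  have e1 : ∫ t, t * g t ∂ν ≤ (∫ x, |x| ∂ν) / 2 * (g ζ - g (-ζ)) := by
    have hb : ∫ t, t * g t ∂ν ≤
        ∫ t, (|t| * ((g ζ - g (-ζ)) / 2) + t * ((g ζ + g (-ζ)) / 2)) ∂ν := by
      refine integral_mono_ae h2 ((hi.abs.mul_const _).add (hi.mul_const _)) ?_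
      filter_upwards [hae] with t ht
      have ha := hmono ht.1
      have hb := hmono ht.2
      rcases le_total 0 t with h | h
      · rw [abs_of_nonneg h]; nlinarith
      · rw [abs_of_nonpos h]; nlinarith
    rw [integral_add (hi.abs.mul_const _) (hi.mul_const _), integral_mul_const,
      integral_mul_const, h0] at hb
    linarith
  have hgi : IntervalIntegrable g' volume (-ζ) ζ :=
    intervalIntegral.intervalIntegrable_deriv_of_nonneg
      (fun t _ => (hd t).continuousAt.continuousWithinAt) (fun t _ => hd t) fun t _ => hg0 t
  have e2 : g ζ - g (-ζ) ≤ (∫ t, g' t ∂ν) / fmin := by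
    rw [← intervalIntegral.integral_eq_sub_of_hasDerivAt (fun t _ => hd t) hgi, le_div_iff₀ hfmin,
      intervalIntegral.integral_of_le hζ, ← integral_Icc_eq_integral_Ioc, ← integral_mul_const]
    have hgI : IntegrableOn g' (Set.Icc (-ζ) ζ) := by
      rw [integrableOn_Icc_iff_integrableOn_Ioc]
      exact (intervalIntegrable_iff_integrableOn_Ioc_of_le hζ).1 hgi
    have h3' := h3
    rw [hν, integrable_withDensity_iff_integrable_smul₀' hf.ennreal_ofReal.aemeasurable
      (Filter.Eventually.of_forall fun x => ENNReal.ofReal_lt_top)] at h3'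
    rw [hν, integral_withDensity_eq_integral_toReal_smul hf.ennreal_ofReal
      (Filter.Eventually.of_forall fun x => ENNReal.ofReal_lt_top)]
    refine integral_mono_ae (hgI.mul_const _) h3' ?_
    filter_upwards [ae_restrict_mem measurableSet_Icc] with x hx
    have hx' := hle x hx
    rw [ENNReal.toReal_ofReal (hfmin.le.trans hx'), smul_eq_mul, mul_comm]
    exact mul_le_mul_of_nonneg_right hx' (hg0 x)
  have e3 : 0 ≤ ∫ x, |x| ∂ν := integral_nonneg fun x => abs_nonneg x
  calc ∫ t, t * g t ∂ν ≤ (∫ x, |x| ∂ν) / 2 * (g ζ - g (-ζ)) := e1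
    _ ≤ (∫ x, |x| ∂ν) / 2 * ((∫ t, g' t ∂ν) / fmin) := by gcongr
    _ = _ := by field_simp

/-! ### Matrices with independent Gaussian entries -/

/-- Here `w` is the logarithm of the ratio of the two densities, and the bound is the exact Gaussian
relative entropy. -/
theorem logDensityBound_gaussianReal (x : ℝ) {g v : ℝ≥0} (hg : g ≠ 0) (hv : v ≠ 0) :
    LogDensityBound (gaussianReal 0 g) (gaussianReal x v)
      ((v / g - 1 - Real.log (v / g) + x ^ 2 / g) / 2) := by
  have hg' : (0 : ℝ) < g := by positivity
  have hv' : (0 : ℝ) < v := by positivity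
  have hL : MemLp (fun t : ℝ => t) 2 (gaussianReal x v) := memLp_id_gaussianReal 2
  have hsq : ∫ t, t ^ 2 ∂(gaussianReal x v) = v + x ^ 2 := by
    have h := variance_eq_sub hL
    rw [variance_fun_id_gaussianReal, integral_id_gaussianReal] at h
    simp only [Pi.pow_apply] at h
    linarith
  have h1 : Integrable (fun t : ℝ => t ^ 2 / (2 * g)) (gaussianReal x v) :=
    hL.integrable_sq.div_const _
  have h2 : Integrable (fun t : ℝ => (t - x) ^ 2 / (2 * v)) (gaussianReal x v) :=
    (hL.sub (memLp_const x)).integrable_sq.div_const _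
  have hsq2 : ∫ t, (t - x) ^ 2 ∂(gaussianReal x v) = v := by
    have h := variance_eq_integral (X := fun t : ℝ => t) (μ := gaussianReal x v)
      measurable_id.aemeasurable
    rw [variance_fun_id_gaussianReal, integral_id_gaussianReal] at h
    exact h.symm
  refine ⟨fun t => t ^ 2 / (2 * g) - (t - x) ^ 2 / (2 * v) - Real.log (v / g) / 2, by fun_prop,
    ?_, (h1.sub h2).sub (integrable_const _), ?_⟩
  · rw [gaussianReal_of_var_ne_zero _ hg, gaussianReal_of_var_ne_zero _ hv,
      ← withDensity_mul _ (measurable_gaussianPDF _ _) (by fun_prop)]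
    congr 1
    ext t
    simp only [Pi.mul_apply, gaussianPDF]
    rw [← ENNReal.ofReal_mul (gaussianPDFReal_nonneg _ _ _)]
    congr 1
    have e1 : Real.exp (Real.log (v / g) / 2) = √v / √g := by
      rw [← Real.log_sqrt (by positivity), Real.exp_log (by positivity), Real.sqrt_div' _ hg'.le]
    have e2 : -(t ^ 2 / (2 * (g : ℝ)) - (t - x) ^ 2 / (2 * v) - Real.log (v / g) / 2)
        = -(t - 0) ^ 2 / (2 * g) + (t - x) ^ 2 / (2 * v) + Real.log (v / g) / 2 := by ring
    rw [e2, Real.exp_add, Real.exp_add, e1, gaussianPDFReal, gaussianPDFReal,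
      Real.sqrt_mul (x := 2 * Real.pi) (by positivity),
      Real.sqrt_mul (x := 2 * Real.pi) (by positivity)]
    have e3 : Real.exp (-(t - x) ^ 2 / (2 * v)) * Real.exp ((t - x) ^ 2 / (2 * v)) = 1 := by
      rw [← Real.exp_add, ← Real.exp_zero]; congr 1; ring
    have hsg : √(g : ℝ) ≠ 0 := by positivity
    have hsv : √(v : ℝ) ≠ 0 := by positivity
    have hsp : √(2 * Real.pi) ≠ 0 := by positivity
    calc (√(2 * Real.pi) * √(g : ℝ))⁻¹ * Real.exp (-(t - 0) ^ 2 / (2 * g))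
        = (√(2 * Real.pi) * √(g : ℝ))⁻¹ * Real.exp (-(t - 0) ^ 2 / (2 * g)) *
          (Real.exp (-(t - x) ^ 2 / (2 * v)) * Real.exp ((t - x) ^ 2 / (2 * v))) := by
          rw [e3, mul_one]
      _ = _ := by field_simp
  · have h3 : Integrable (fun t : ℝ => t ^ 2 / (2 * g) - (t - x) ^ 2 / (2 * v))
      (gaussianReal x v) := h1.sub h2
    rw [integral_sub h3 (integrable_const _), integral_sub h1 h2, integral_div,
      integral_div, hsq, hsq2]
    simp only [integral_const, probReal_univ, smul_eq_mul, one_mul]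
    refine le_of_eq ?_
    field_simp
    ring

/-- The law of a matrix with independent entries, the entry `(i, j)` being `N(M i j, v j)`. -/
noncomputable def matGaussian {q k : ℕ} (M : Fin q → Fin k → ℝ) (v : Fin k → ℝ≥0) :
    Measure (Fin q → Fin k → ℝ) :=
  Measure.pi fun i => Measure.pi fun j => gaussianReal (M i j) (v j)

instance {q k : ℕ} (M : Fin q → Fin k → ℝ) (v : Fin k → ℝ≥0) :
    IsProbabilityMeasure (matGaussian M v) := by
  unfold matGaussian; infer_instance

theorem logDensityBound_colGaussian {q k : ℕ} {γ : Fin k → ℝ} {M : Fin q → Fin k → ℝ}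
    {v : Fin k → ℝ≥0} {K : Fin q → Fin k → ℝ}
    (h : ∀ i j, LogDensityBound (gaussianReal 0 (γ j).toNNReal) (gaussianReal (M i j) (v j))
      (K i j)) :
    LogDensityBound (colGaussian q k γ) (matGaussian M v) (∑ i, ∑ j, K i j) :=
  LogDensityBound.pi fun i => LogDensityBound.pi fun j => h i j

/-! ### Moments of linear forms in independent Gaussian entries. -/

theorem memLp_sum_pi {ι : Type*} [Fintype ι] {Ω : ι → Type*} [∀ i, MeasurableSpace (Ω i)]
    {μ : ∀ i, Measure (Ω i)} [∀ i, IsProbabilityMeasure (μ i)] {X : ∀ i, Ω i → ℝ}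
    (h : ∀ i, MemLp (X i) 2 (μ i)) :
    MemLp (fun ω : ∀ i, Ω i => ∑ i, X i (ω i)) 2 (Measure.pi μ) :=
  memLp_finsetSum _ fun i _ => (h i).comp_measurePreserving (measurePreserving_eval μ i)

theorem integral_sum_pi {ι : Type*} [Fintype ι] {Ω : ι → Type*} [∀ i, MeasurableSpace (Ω i)]
    {μ : ∀ i, Measure (Ω i)} [∀ i, IsProbabilityMeasure (μ i)] {X : ∀ i, Ω i → ℝ}
    (h : ∀ i, MemLp (X i) 2 (μ i)) :
    ∫ ω, ∑ i, X i (ω i) ∂(Measure.pi μ) = ∑ i, ∫ x, X i x ∂(μ i) := by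
  rw [integral_finsetSum _ fun i _ => integrable_comp_eval ((h i).integrable (by norm_num))]
  exact Finset.sum_congr rfl fun i _ => integral_comp_eval (h i).aestronglyMeasurable

theorem variance_fun_sum_pi {ι : Type*} [Fintype ι] {Ω : ι → Type*} [∀ i, MeasurableSpace (Ω i)]
    {μ : ∀ i, Measure (Ω i)} [∀ i, IsProbabilityMeasure (μ i)] {X : ∀ i, Ω i → ℝ}
    (h : ∀ i, MemLp (X i) 2 (μ i)) :
    Var[fun ω => ∑ i, X i (ω i); Measure.pi μ] = ∑ i, Var[X i; μ i] := by
  rw [← variance_sum_pi h]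
  congr 1
  ext ω
  simp

section

variable {q k : ℕ} (M : Fin q → Fin k → ℝ) (v : Fin k → ℝ≥0) (w : Fin q → Fin k → ℝ)

theorem memLp_const_mul_gaussianReal (c x : ℝ) (g : ℝ≥0) :
    MemLp (fun t : ℝ => c * t) 2 (gaussianReal x g) :=
  (memLp_id_gaussianReal 2).const_mul c

theorem memLp_linear_matGaussian :
    MemLp (fun U : Fin q → Fin k → ℝ => ∑ i, ∑ j, w i j * U i j) 2 (matGaussian M v) :=
  memLp_sum_pi (X := fun i (u : Fin k → ℝ) => ∑ j, w i j * u j) fun _ =>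
    memLp_sum_pi (X := fun _ (t : ℝ) => _ * t) fun _ => memLp_const_mul_gaussianReal _ _ _

theorem integral_linear_matGaussian :
    ∫ U, ∑ i, ∑ j, w i j * U i j ∂(matGaussian M v) = ∑ i, ∑ j, w i j * M i j := by
  rw [matGaussian, integral_sum_pi (X := fun i (u : Fin k → ℝ) => ∑ j, w i j * u j) fun _ =>
    memLp_sum_pi (X := fun _ (t : ℝ) => _ * t) fun _ => memLp_const_mul_gaussianReal _ _ _]
  refine Finset.sum_congr rfl fun i _ => ?_
  rw [integral_sum_pi (X := fun j (t : ℝ) => w i j * t) fun _ =>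
    memLp_const_mul_gaussianReal _ _ _]
  refine Finset.sum_congr rfl fun j _ => ?_
  rw [integral_const_mul, integral_id_gaussianReal]

theorem variance_linear_matGaussian :
    Var[fun U => ∑ i, ∑ j, w i j * U i j; matGaussian M v] = ∑ i, ∑ j, w i j ^ 2 * v j := by
  rw [matGaussian, variance_fun_sum_pi (X := fun i (u : Fin k → ℝ) => ∑ j, w i j * u j) fun _ =>
    memLp_sum_pi (X := fun _ (t : ℝ) => _ * t) fun _ => memLp_const_mul_gaussianReal _ _ _]
  refine Finset.sum_congr rfl fun i _ => ?_
  rw [variance_fun_sum_pi (X := fun j (t : ℝ) => w i j * t) fun _ =>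
    memLp_const_mul_gaussianReal _ _ _]
  refine Finset.sum_congr rfl fun j _ => ?_
  rw [variance_const_mul, variance_fun_id_gaussianReal]

theorem integrable_sq_affine_matGaussian (c : ℝ) :
    Integrable (fun U : Fin q → Fin k → ℝ => (c - ∑ i, ∑ j, w i j * U i j) ^ 2)
      (matGaussian M v) :=
  ((memLp_const c).sub (memLp_linear_matGaussian M v w)).integrable_sq

theorem integral_sq_affine_matGaussian (c : ℝ) :
    ∫ U, (c - ∑ i, ∑ j, w i j * U i j) ^ 2 ∂(matGaussian M v) =
      (c - ∑ i, ∑ j, w i j * M i j) ^ 2 + ∑ i, ∑ j, w i j ^ 2 * v j := by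
  have hL := memLp_linear_matGaussian M v w
  have h := variance_eq_sub ((memLp_const c).sub hL)
  have e : Var[(fun _ => c) - fun U => ∑ i, ∑ j, w i j * U i j; matGaussian M v]
      = Var[fun U => ∑ i, ∑ j, w i j * U i j; matGaussian M v] :=
    variance_const_sub hL.aestronglyMeasurable c
  rw [e, variance_linear_matGaussian] at h
  simp only [Pi.sub_apply, Pi.pow_apply] at h
  rw [integral_sub (integrable_const _) (hL.integrable (by norm_num)),
    integral_linear_matGaussian] at h
  simp only [integral_const, probReal_univ, smul_eq_mul, one_mul] at h
  linarith

end

/-! ### The regression function under independent Gaussian factors -/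

theorem mul_prodMat_apply {l p m k : ℕ} (X : Matrix (Fin l) (Fin p) ℝ) (θ : Pairs p m k)
    (i : Fin l) (h : Fin m) :
    (X * prodMat θ) i h = ∑ j, (∑ a, X i a * θ.1 a j) * θ.2 h j := by
  simp only [prodMat, Matrix.mul_apply, Matrix.of_apply, Matrix.transpose_apply, Finset.mul_sum,
    Finset.sum_mul]
  rw [Finset.sum_comm]
  exact Finset.sum_congr rfl fun j _ => Finset.sum_congr rfl fun a _ => by ring

theorem measurable_mul_prodMat {l p m k : ℕ} (X : Matrix (Fin l) (Fin p) ℝ)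
    (i : Fin l) (h : Fin m) :
    Measurable fun θ : Pairs p m k => (X * prodMat θ) i h := by
  simp only [mul_prodMat_apply]
  fun_prop

section

variable {l p m k : ℕ} (X : Matrix (Fin l) (Fin p) ℝ) (M : Fin p → Fin k → ℝ)
  (N : Fin m → Fin k → ℝ) (v w : Fin k → ℝ≥0)

theorem memLp_mul_prodMat (i : Fin l) (h : Fin m) :
    MemLp (fun θ : Pairs p m k => (X * prodMat θ) i h) 2
      ((matGaussian M v).prod (matGaussian N w)) := by
  simp only [mul_prodMat_apply]
  refine memLp_finsetSum _ fun j _ => ?_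
  have h1 : MemLp (fun U : Fin p → Fin k → ℝ => ∑ a, X i a * U a j) 2 (matGaussian M v) := by
    have := memLp_linear_matGaussian M v fun a j' => if j' = j then X i a else 0
    simpa using this
  have h2 : MemLp (fun V : Fin m → Fin k → ℝ => V h j) 2 (matGaussian N w) := by
    have := memLp_linear_matGaussian N w fun h' j' => if h' = h ∧ j' = j then 1 else 0
    simpa [ite_and] using this
  refine (memLp_two_iff_integrable_sq
    (h1.aestronglyMeasurable.comp_fst.mul h2.aestronglyMeasurable.comp_snd)).2 ?_
  refine (h1.integrable_sq.mul_prod h2.integrable_sq).congr (Filter.Eventually.of_forall fun z => ?_)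
  simp only [Pi.mul_apply]; ring

/-- For fixed first factor the entry is linear in the second, so the inner integral is squared bias
plus variance. Both are sums of squares of affine functions of the first factor, and the same
formula applies again. -/
theorem integral_sq_sub_mul_prodMat (c : ℝ) (i : Fin l) (h : Fin m) :
    ∫ θ, (c - (X * prodMat θ) i h) ^ 2 ∂((matGaussian M v).prod (matGaussian N w)) =
      (c - (X * prodMat (M, N)) i h) ^ 2 + ∑ a, ∑ j, X i a ^ 2 * N h j ^ 2 * v j +
        ∑ j, w j * ((∑ a, X i a * M a j) ^ 2 + ∑ a, X i a ^ 2 * v j) := by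
  refine (integral_prod _
    ((memLp_const c).sub (memLp_mul_prodMat X M N v w i h)).integrable_sq).trans ?_
  simp only [Pi.sub_apply]
  have h1 : ∀ U : Fin p → Fin k → ℝ,
      ∫ V, (c - (X * prodMat (U, V)) i h) ^ 2 ∂(matGaussian N w) =
      (c - ∑ a, ∑ j, (X i a * N h j) * U a j) ^ 2 +
        ∑ j, w j * (0 - ∑ a, ∑ j', (if j' = j then X i a else 0) * U a j') ^ 2 := by
    intro U
    -- Indicator weights select row `h` inside the full double sum.
    have := integral_sq_affine_matGaussian N w
      (fun h' j => if h' = h then ∑ a, X i a * U a j else 0) c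
    simp only [ite_mul, zero_mul, ite_pow, ne_eq, OfNat.ofNat_ne_zero, not_false_eq_true,
      zero_pow] at this
    simp only [Finset.sum_comm (f := fun (h' : Fin m) (j : Fin k) => ite _ _ _),
      Finset.sum_ite_eq', Finset.mem_univ, if_true] at this
    simp only [mul_prodMat_apply]
    rw [this]
    congr 2
    · congr 1
      rw [Finset.sum_comm]
      exact Finset.sum_congr rfl fun j _ => by
        rw [Finset.sum_mul]; exact Finset.sum_congr rfl fun a _ => by ring
    · ext j
      simp only [ite_mul, zero_mul, Finset.sum_ite_eq', Finset.mem_univ, if_true]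
      ring
  have hi : ∀ j, Integrable (fun U : Fin p → Fin k → ℝ =>
      (w j : ℝ) * (0 - ∑ a, ∑ j', (if j' = j then X i a else 0) * U a j') ^ 2)
      (matGaussian M v) := fun j =>
    (integrable_sq_affine_matGaussian M v _ 0).const_mul _
  simp only [h1]
  rw [integral_add (integrable_sq_affine_matGaussian M v _ c)
    (integrable_finsetSum _ fun j _ => hi j), integral_finsetSum _ fun j _ => hi j,
    integral_sq_affine_matGaussian]
  congr 1
  · congr 1
    · congr 2
      rw [mul_prodMat_apply, Finset.sum_comm]
      exact Finset.sum_congr rfl fun j _ => by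
        rw [Finset.sum_mul]; exact Finset.sum_congr rfl fun a _ => by ring
    · exact Finset.sum_congr rfl fun a _ => Finset.sum_congr rfl fun j _ => by ring
  · refine Finset.sum_congr rfl fun j _ => ?_
    rw [integral_const_mul, integral_sq_affine_matGaussian]
    simp only [ite_mul, zero_mul, ite_pow, ne_eq, OfNat.ofNat_ne_zero, not_false_eq_true,
      zero_pow, Finset.sum_ite_eq', Finset.mem_univ, if_true]
    ring

end

/-! ### Lower bounds for the hyperprior -/

theorem gammaPDF_one {b x : ℝ} (hx : 0 ≤ x) :
    gammaPDF 1 b x = ENNReal.ofReal (b * Real.exp (-(b * x))) := by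
  rw [gammaPDF_of_nonneg hx]; simp

/-- The event contains `1/γ ∈ [1, 2]`, an interval of length one on which the exponential density is
at least `b * exp (-2b)`. -/
theorem le_invGammaMeasure_Icc {b : ℝ} (hb : 0 < b) :
    ENNReal.ofReal (b * Real.exp (-(2 * b))) ≤ invGammaMeasure 1 b (Set.Icc (1 / 2) 1) := by
  rw [invGammaMeasure, Measure.map_apply (by fun_prop) measurableSet_Icc]
  have hsub : Set.Icc (1 : ℝ) 2 ⊆ (fun x : ℝ => x⁻¹) ⁻¹' Set.Icc (1 / 2) 1 := by
    intro x hx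
    have hx0 : 0 < x := by linarith [hx.1]
    refine ⟨?_, inv_le_one_of_one_le₀ hx.1⟩
    rw [one_div]; exact (inv_le_inv₀ (by norm_num) hx0).2 hx.2
  refine le_trans ?_ (measure_mono hsub)
  rw [gammaMeasure, withDensity_apply _ measurableSet_Icc]
  calc ENNReal.ofReal (b * Real.exp (-(2 * b)))
      = ∫⁻ x in Set.Icc (1 : ℝ) 2, ENNReal.ofReal (b * Real.exp (-(2 * b))) := by
        rw [setLIntegral_const, Real.volume_Icc]; norm_num
    _ ≤ _ := by
        refine setLIntegral_mono' measurableSet_Icc fun x hx => ?_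
        have hx1 : (1 : ℝ) ≤ x := hx.1
        rw [gammaPDF_one (by linarith)]
        have hx2 : x ≤ 2 := hx.2
        exact ENNReal.ofReal_le_ofReal (mul_le_mul_of_nonneg_left
          (Real.exp_le_exp.2 (by nlinarith)) hb.le)

/-- The exponential density is at most `b`, so `1/γ < T` has probability at most `b * T`. -/
theorem half_le_invGammaMeasure_Ioc {b T : ℝ} (hb : 0 < b) (hT : 0 < T) (hbT : b * T ≤ 1 / 2) :
    ENNReal.ofReal (1 / 2) ≤ invGammaMeasure 1 b (Set.Ioc 0 (1 / T)) := by
  have := isProbabilityMeasure_gammaMeasure one_pos hb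
  rw [invGammaMeasure, Measure.map_apply (by fun_prop) measurableSet_Ioc]
  have hsub : Set.Ici T ⊆ (fun x : ℝ => x⁻¹) ⁻¹' Set.Ioc 0 (1 / T) := by
    intro x hx
    have hx0 : 0 < x := lt_of_lt_of_le hT hx
    exact ⟨inv_pos.2 hx0, by rw [one_div]; exact (inv_le_inv₀ hx0 hT).2 hx⟩
  refine le_trans ?_ (measure_mono hsub)
  have hlow : gammaMeasure 1 b (Set.Iio T) ≤ ENNReal.ofReal (1 / 2) := by
    rw [gammaMeasure, withDensity_apply _ measurableSet_Iio]
    calc ∫⁻ x in Set.Iio T, gammaPDF 1 b x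
        ≤ ∫⁻ x in Set.Iio T, (Set.Icc 0 T).indicator (fun _ => ENNReal.ofReal b) x := by
          refine setLIntegral_mono' measurableSet_Iio fun x hx => ?_
          rcases lt_or_ge x 0 with h | h
          · rw [gammaPDF_of_neg h]; exact zero_le
          · have hxT : x ∈ Set.Icc 0 T := ⟨h, le_of_lt hx⟩
            rw [Set.indicator_of_mem hxT, gammaPDF_one h]
            refine ENNReal.ofReal_le_ofReal ?_
            have : Real.exp (-(b * x)) ≤ 1 := Real.exp_le_one_iff.2 (by nlinarith)
            nlinarith
      _ ≤ ∫⁻ x, (Set.Icc 0 T).indicator (fun _ => ENNReal.ofReal b) x := setLIntegral_le_lintegral _ _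
      _ = ENNReal.ofReal (b * T) := by
          rw [lintegral_indicator measurableSet_Icc, setLIntegral_const, Real.volume_Icc,
            ← ENNReal.ofReal_mul hb.le, sub_zero]
      _ ≤ _ := ENNReal.ofReal_le_ofReal hbT
  have hc : Set.Ici T = (Set.Iio T)ᶜ := by ext; simp
  rw [hc, prob_compl_eq_one_sub measurableSet_Iio]
  calc ENNReal.ofReal (1 / 2) = 1 - ENNReal.ofReal (1 / 2) := by
        rw [← ENNReal.ofReal_one, ← ENNReal.ofReal_sub _ (by norm_num)]; norm_num
    _ ≤ _ := tsub_le_tsub_left hlow _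

/-- The hyperparameters of the columns in `J` are of order one, the others at most `1 / W`. -/
def hyperSet {k : ℕ} (J : Finset (Fin k)) (W : ℝ) : Set (Fin k → ℝ) :=
  Set.univ.pi fun j => if j ∈ J then Set.Icc (1 / 2) 1 else Set.Ioc 0 (1 / W)

theorem measurableSet_hyperSet {k : ℕ} (J : Finset (Fin k)) (W : ℝ) :
    MeasurableSet (hyperSet J W) := by
  refine MeasurableSet.univ_pi fun j => ?_
  split_ifs
  exacts [measurableSet_Icc, measurableSet_Ioc]

/-- A column in `J` has mass at least `1 / (6 * W)`, because `2 * b = 1 / W ≤ 1`; any other has mass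
at least `1 / 2`. Both exceed `1 / (22.17 * W)`, so one constant serves every column and every `J`.
-/
theorem le_hyperPrior_hyperSet {k : ℕ} (J : Finset (Fin k)) {W b : ℝ} (hW : 1 ≤ W)
    (hb : b = 1 / (2 * W)) :
    ENNReal.ofReal ((1 / (22.17 * W)) ^ k) ≤ hyperPrior k 1 b (hyperSet J W) := by
  have hW0 : 0 < W := by linarith
  have hb0 : 0 < b := by rw [hb]; positivity
  have := isProbabilityMeasure_gammaMeasure one_pos hb0
  have h1 : IsProbabilityMeasure (invGammaMeasure 1 b) :=
    Measure.isProbabilityMeasure_map (by fun_prop)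
  rw [hyperPrior, hyperSet, Measure.pi_pi, ENNReal.ofReal_pow (by positivity)]
  calc ENNReal.ofReal (1 / (22.17 * W)) ^ k
      = ∏ _j : Fin k, ENNReal.ofReal (1 / (22.17 * W)) := by simp
    _ ≤ _ := by
      refine Finset.prod_le_prod' fun j _ => ?_
      split_ifs
      · refine le_trans (ENNReal.ofReal_le_ofReal ?_) (le_invGammaMeasure_Icc hb0)
        have e1 : 1 / 3 ≤ Real.exp (-(2 * b)) := by
          have h2 : 2 * b ≤ 1 := by
            rw [hb]
            have : 2 * (1 / (2 * W)) = 1 / W := by field_simp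
            rw [this, div_le_one hW0]; exact hW
          calc (1 : ℝ) / 3 ≤ 1 / Real.exp 1 := by
                gcongr; linarith [Real.exp_one_lt_d9]
            _ = Real.exp (-1) := by rw [Real.exp_neg, one_div]
            _ ≤ _ := Real.exp_le_exp.2 (by linarith)
        calc 1 / (22.17 * W) ≤ 1 / (2 * W) * (1 / 3) := by
              rw [div_mul_div_comm, div_le_div_iff₀ (by positivity) (by positivity)]; nlinarith
          _ ≤ b * Real.exp (-(2 * b)) := by rw [← hb]; gcongr
      · refine le_trans (ENNReal.ofReal_le_ofReal ?_)
          (half_le_invGammaMeasure_Ioc hb0 hW0 (by rw [hb]; field_simp; norm_num))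
        rw [div_le_div_iff₀ (by positivity) (by positivity)]; linarith

/-! ### A bound for the empirical loss under the quasi-posterior -/

/-- The entries of `X M Nᵀ`, indexed by pairs. -/
def regFun {l p m k : ℕ} (X : Matrix (Fin l) (Fin p) ℝ) (ih : Fin l × Fin m) (θ : Pairs p m k) :
    ℝ := (X * prodMat θ) ih.1 ih.2

theorem measurable_regFun {l p m k : ℕ} (X : Matrix (Fin l) (Fin p) ℝ) (ih : Fin l × Fin m) :
    Measurable (regFun (k := k) X ih) := measurable_mul_prodMat X ih.1 ih.2

/-- Restricting the mixture to `A` makes the hyperprior enter only through its mass `δ`;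
Donsker-Varadhan is then used inside each conditional prior. The comparison law `ρ` may depend on
`γ`, but the bounds `K` and `S` may not. -/
theorem integral_loss_gibbs_prior_le {l p m k : ℕ} {X : Matrix (Fin l) (Fin p) ℝ} {a b lam : ℝ}
    (ha : 0 < a) (hb : 0 < b) (hlam : 0 < lam) {A : Set (Fin k → ℝ)} (hA : MeasurableSet A)
    {δ K S : ℝ} (hδ : 0 < δ) (hAδ : ENNReal.ofReal δ ≤ hyperPrior k a b A)
    (f0 : Fin l × Fin m → ℝ)
    (h : ∀ γ ∈ A, ∃ ρ : Measure (Pairs p m k), IsProbabilityMeasure ρ ∧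
      LogDensityBound (priorGiven p m k γ) ρ K ∧ ∀ y : Fin l × Fin m → ℝ,
        Integrable (fun θ => ∑ i, (y i - regFun X i θ) ^ 2) ρ ∧
        ∫ θ, ∑ i, (y i - regFun X i θ) ^ 2 ∂ρ ≤ ∑ i, (y i - f0 i) ^ 2 + S)
    (y : Fin l × Fin m → ℝ) :
    ∫ θ, ∑ i, (y i - regFun X i θ) ^ 2 ∂(gibbs (prior p m k a b) (regFun X) lam y) ≤
      ∑ i, (y i - f0 i) ^ 2 + (S + (K - Real.log δ) / lam) := by
  have hprob := isProbabilityMeasure_prior p m k ha hb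
  have hφ := fun ih => measurable_regFun (k := k) (m := m) X ih
  set r : Pairs p m k → ℝ := fun θ => lam * ∑ i, (y i - regFun X i θ) ^ 2 with hr
  have hrm : Measurable r := by fun_prop
  have hg : gibbs (prior p m k a b) (regFun X) lam y = (prior p m k a b).tilted fun θ => -r θ := by
    simp only [gibbs, hr, neg_mul]
  have hexp : Integrable (fun θ => Real.exp (-r θ)) (prior p m k a b) := by
    simpa only [hr, neg_mul] using integrable_exp_neg_loss hφ hlam y
  have hint := (integrable_loss_gibbs (μ := prior p m k a b) hφ hlam y).const_mul lam
  have h1 := integral_tilted_neg_le (r := r) hexp (hg ▸ hint)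
  rw [← hg] at h1
  simp only [hr, integral_const_mul] at h1
  set D := lam * (∑ i, (y i - f0 i) ^ 2 + S) + K with hD
  have h2 : ENNReal.ofReal (Real.exp (-D) * δ) ≤
      ENNReal.ofReal (∫ θ, Real.exp (-r θ) ∂(prior p m k a b)) := by
    rw [ofReal_integral_eq_lintegral_ofReal hexp (Filter.Eventually.of_forall fun θ =>
      Real.exp_nonneg _), prior, Measure.lintegral_bind (measurable_priorGiven p m k).aemeasurable
      (by fun_prop), ENNReal.ofReal_mul (Real.exp_nonneg _)]
    calc ENNReal.ofReal (Real.exp (-D)) * ENNReal.ofReal δ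
        ≤ ENNReal.ofReal (Real.exp (-D)) * hyperPrior k a b A := by gcongr
      _ = ∫⁻ _ in A, ENNReal.ofReal (Real.exp (-D)) ∂(hyperPrior k a b) := by
          rw [setLIntegral_const]
      _ ≤ ∫⁻ γ in A, ∫⁻ θ, ENNReal.ofReal (Real.exp (-r θ)) ∂(priorGiven p m k γ)
            ∂(hyperPrior k a b) := by
          refine setLIntegral_mono' hA fun γ hγ => ?_
          obtain ⟨ρ, hρ, hLD, hy⟩ := h γ hγ
          obtain ⟨hy1, hy2⟩ := hy y
          refine le_trans (ENNReal.ofReal_le_ofReal (Real.exp_le_exp.2 ?_))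
            (hLD.exp_le_lintegral hrm (hy1.const_mul lam))
          simp only [hr, integral_const_mul]
          have := mul_le_mul_of_nonneg_left hy2 hlam.le
          linarith
      _ ≤ _ := setLIntegral_le_lintegral _ _
  have h3 : Real.exp (-D) * δ ≤ ∫ θ, Real.exp (-r θ) ∂(prior p m k a b) :=
    (ENNReal.ofReal_le_ofReal_iff (integral_exp_pos hexp).le).1 h2
  have h4 := Real.log_le_log (by positivity) h3
  rw [Real.log_mul (Real.exp_ne_zero _) hδ.ne', Real.log_exp] at h4
  have h5 : lam * ∫ θ, ∑ i, (y i - regFun X i θ) ^ 2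
      ∂(gibbs (prior p m k a b) (regFun X) lam y) ≤
      lam * (∑ i, (y i - f0 i) ^ 2 + (S + (K - Real.log δ) / lam)) := by
    have e : lam * (∑ i, (y i - f0 i) ^ 2 + (S + (K - Real.log δ) / lam))
        = D - Real.log δ := by rw [hD]; field_simp; ring
    rw [e]; linarith
  exact le_of_mul_le_mul_left h5 hlam

theorem integrable_sq_sub_regFun {l p m k : ℕ} (X : Matrix (Fin l) (Fin p) ℝ)
    (M : Fin p → Fin k → ℝ) (N : Fin m → Fin k → ℝ) (v w : Fin k → ℝ≥0) (c : ℝ)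
    (i : Fin l × Fin m) :
    Integrable (fun θ => (c - regFun X i θ) ^ 2) ((matGaussian M v).prod (matGaussian N w)) :=
  ((memLp_const c).sub (memLp_mul_prodMat X M N v w i.1 i.2)).integrable_sq

/-- Bound for the mean loss when the columns of `M` and `N` outside `J` vanish. -/
theorem integral_loss_matGaussian_le {l p m k : ℕ} (X : Matrix (Fin l) (Fin p) ℝ)
    (M : Fin p → Fin k → ℝ) (N : Fin m → Fin k → ℝ) {v w : Fin k → ℝ≥0}
    {x z δ : ℝ} (hvN : ∀ h j, N h j ^ 2 * v j ≤ N h j ^ 2 * x)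
    (hwM : ∀ a j, M a j ^ 2 * w j ≤ M a j ^ 2 * z) (hvw : ∀ j, (w j : ℝ) * v j ≤ δ)
    (y : Fin l × Fin m → ℝ) :
    ∫ θ, ∑ i, (y i - regFun X i θ) ^ 2 ∂((matGaussian M v).prod (matGaussian N w)) ≤
      ∑ i, (y i - regFun X i (M, N)) ^ 2 +
        frobSq X * (x * frobSq (Matrix.of N) + m * z * frobSq (Matrix.of M) + m * k * δ) := by
  rw [integral_finsetSum _ fun i _ => integrable_sq_sub_regFun X M N v w (y i) i]
  have hone : ∀ i : Fin l × Fin m, ∫ θ, (y i - regFun X i θ) ^ 2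
        ∂((matGaussian M v).prod (matGaussian N w)) ≤
      (y i - regFun X i (M, N)) ^ 2 +
        (∑ a, X i.1 a ^ 2) * (x * ∑ j, N i.2 j ^ 2 + z * frobSq (Matrix.of M) + k * δ) := by
    rintro ⟨i, h⟩
    refine (integral_sq_sub_mul_prodMat X M N v w (y (i, h)) i h).le.trans ?_
    rw [add_assoc]
    refine add_le_add le_rfl ?_
    have e1 : ∑ a, ∑ j, X i a ^ 2 * N h j ^ 2 * v j ≤
        (∑ a, X i a ^ 2) * (x * ∑ j, N h j ^ 2) := by
      rw [Finset.sum_mul]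
      refine Finset.sum_le_sum fun a _ => ?_
      rw [Finset.mul_sum, Finset.mul_sum]
      refine Finset.sum_le_sum fun j _ => ?_
      have := mul_le_mul_of_nonneg_left (hvN h j) (sq_nonneg (X i a))
      linarith
    have e2 : ∑ j, (w j : ℝ) * (∑ a, X i a * M a j) ^ 2 ≤ (∑ a, X i a ^ 2) * (z * frobSq (Matrix.of M)) := by
      have : frobSq (Matrix.of M) = ∑ j, ∑ a, M a j ^ 2 := Finset.sum_comm
      rw [this, Finset.mul_sum, Finset.mul_sum]
      refine Finset.sum_le_sum fun j _ => ?_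
      have hcs := Finset.sum_mul_sq_le_sq_mul_sq Finset.univ (fun a => X i a) (fun a => M a j)
      have h2 : ∑ a, M a j ^ 2 * (w j : ℝ) ≤ ∑ a, M a j ^ 2 * z :=
        Finset.sum_le_sum fun a _ => hwM a j
      rw [← Finset.sum_mul, ← Finset.sum_mul] at h2
      have h3 : 0 ≤ ∑ a, X i a ^ 2 := Finset.sum_nonneg fun a _ => sq_nonneg _
      calc (w j : ℝ) * (∑ a, X i a * M a j) ^ 2
          ≤ w j * ((∑ a, X i a ^ 2) * ∑ a, M a j ^ 2) := by gcongr
        _ = (∑ a, X i a ^ 2) * ((∑ a, M a j ^ 2) * w j) := by ring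
        _ ≤ (∑ a, X i a ^ 2) * ((∑ a, M a j ^ 2) * z) := by gcongr
        _ = _ := by ring
    have e3 : ∑ j, (w j : ℝ) * ∑ a, X i a ^ 2 * v j ≤ (∑ a, X i a ^ 2) * (k * δ) := by
      have h3 : 0 ≤ ∑ a, X i a ^ 2 := Finset.sum_nonneg fun a _ => sq_nonneg _
      calc ∑ j, (w j : ℝ) * ∑ a, X i a ^ 2 * v j
          ≤ ∑ _j : Fin k, (∑ a, X i a ^ 2) * δ := by
            refine Finset.sum_le_sum fun j _ => ?_
            rw [← Finset.sum_mul]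
            calc (w j : ℝ) * ((∑ a, X i a ^ 2) * v j) = (∑ a, X i a ^ 2) * (w j * v j) := by ring
              _ ≤ _ := by gcongr; exact hvw j
        _ = _ := by simp; ring
    have e4 : ∑ j, (w j : ℝ) * ((∑ a, X i a * M a j) ^ 2 + ∑ a, X i a ^ 2 * v j) =
        ∑ j, (w j : ℝ) * (∑ a, X i a * M a j) ^ 2 + ∑ j, (w j : ℝ) * ∑ a, X i a ^ 2 * v j := by
      rw [← Finset.sum_add_distrib]; exact Finset.sum_congr rfl fun j _ => by ring
    rw [e4]
    linarith
  refine (Finset.sum_le_sum fun i _ => hone i).trans (le_of_eq ?_)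
  rw [Finset.sum_add_distrib]
  congr 1
  rw [Fintype.sum_prod_type]
  simp only [← Finset.mul_sum]
  rw [← Finset.sum_mul]
  change frobSq X * _ = _
  congr 1
  rw [Finset.sum_add_distrib, Finset.sum_add_distrib, ← Finset.mul_sum]
  simp only [Finset.sum_const, Finset.card_univ, Fintype.card_fin, nsmul_eq_mul]
  simp only [frobSq, Matrix.of_apply]
  ring

/-- In the Gaussian relative entropy, `x ≤ 1/2 ≤ g` makes `x / g - 1` nonpositive and `u ^ 2 / g ≤ 2
* u ^ 2`. The logarithm is controlled by `2 * L * c ≤ 2 * L ^ 3 ≤ (1.34 * L) ^ 3`, since `1.34 ^ 3 >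
2`. -/
theorem logDensityBound_entry {L c g x : ℝ} (hL : 1 ≤ L) (hc : 1 ≤ c) (hcL : c ≤ L ^ 2)
    (hg : g ∈ Set.Icc (1 / 2 : ℝ) 1) (hx : x = 1 / (2 * L * c)) (u : ℝ) :
    LogDensityBound (gaussianReal 0 g.toNNReal) (gaussianReal u x.toNNReal)
      (3 / 2 * Real.log (1.34 * L) + u ^ 2) := by
  obtain ⟨hg1, hg2⟩ : 1 / 2 ≤ g ∧ g ≤ 1 := hg
  have hg0 : 0 < g := by linarith
  have hL0 : 0 < L := by linarith
  have hc0 : 0 < c := by linarith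
  have hx0 : 0 < x := by rw [hx]; positivity
  refine (logDensityBound_gaussianReal u (g := g.toNNReal) (v := x.toNNReal)
    (by simpa using hg0) (by simpa using hx0)).mono ?_
  rw [Real.coe_toNNReal _ hg0.le, Real.coe_toNNReal _ hx0.le]
  have hxg : x / g ≤ 1 := by
    rw [div_le_one hg0]
    refine le_trans ?_ hg1
    rw [hx]
    exact one_div_le_one_div_of_le (by norm_num) (by nlinarith)
  have hlow : 1 / (1.34 * L) ^ 3 ≤ x / g := by
    calc 1 / (1.34 * L) ^ 3 ≤ 1 / (2 * L * c) := by
          refine one_div_le_one_div_of_le (by positivity) ?_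
          have h1 : 2 * L * c ≤ 2 * L * L ^ 2 := by gcongr
          have h2 : 0 ≤ L ^ 3 := by positivity
          nlinarith
      _ = x := hx.symm
      _ ≤ x / g := by rw [le_div_iff₀ hg0]; nlinarith
  have hlog := Real.log_le_log (by positivity) hlow
  rw [one_div, Real.log_inv, Real.log_pow] at hlog
  have hu : u ^ 2 / g ≤ 2 * u ^ 2 := by
    rw [div_le_iff₀ hg0]; nlinarith [sq_nonneg u]
  push_cast at hlog
  linarith

/-- Bound for the empirical loss under the quasi-posterior, in terms of a pair of matrices whose
columns outside `J` vanish. -/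
theorem integral_loss_gibbs_le {l p m k : ℕ} (X : Matrix (Fin l) (Fin p) ℝ)
    {M : Fin p → Fin k → ℝ} {N : Fin m → Fin k → ℝ} {J : Finset (Fin k)}
    (hM : ∀ j, j ∉ J → ∀ i, M i j = 0) (hN : ∀ j, j ∉ J → ∀ h, N h j = 0)
    {L W b lam : ℝ} (hk : 1 ≤ k) (hkm : k ≤ m) (hL : √(m : ℝ) ≤ L)
    (hW : W = L * (k : ℝ) ^ 2 * ((m : ℝ) ^ 2 + (p : ℝ) ^ 2)) (hb : b = 1 / (2 * W))
    (hlam : 0 < lam) (y : Fin l × Fin m → ℝ) :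
    ∫ θ, ∑ i, (y i - regFun X i θ) ^ 2 ∂(gibbs (prior p m k 1 b) (regFun X) lam y) ≤
      ∑ i, (y i - regFun X i (M, N)) ^ 2 +
        (frobSq X * ((frobSq (Matrix.of N) + frobSq (Matrix.of M)) / (2 * L) + 1 / L ^ 2) +
        (((m : ℝ) + p) * J.card * (3 / 2 * Real.log (1.34 * L)) + frobSq (Matrix.of M) +
          frobSq (Matrix.of N) + k * Real.log (22.17 * W)) / lam) := by
  have hk1 : (1 : ℝ) ≤ k := by exact_mod_cast hk
  have hkm1 : (k : ℝ) ≤ m := by exact_mod_cast hkm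
  have hm1 : (1 : ℝ) ≤ m := hk1.trans hkm1
  have hL1 : 1 ≤ L := (Real.one_le_sqrt.2 hm1).trans hL
  have hL0 : 0 < L := by linarith
  have hmL : (m : ℝ) ≤ L ^ 2 := (Real.sqrt_le_left hL0.le).1 hL
  have hW2 : L * k * m ≤ W ∧ 1 ≤ W := by
    have h1 : (1 : ℝ) * m ≤ (k : ℝ) * m ^ 2 := by nlinarith
    have h2 : L * (k : ℝ) * m ≤ W := by
      rw [hW]
      calc L * (k : ℝ) * m ≤ L * (k : ℝ) * (k * m ^ 2) := by gcongr; linarith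
        _ ≤ L * (k : ℝ) ^ 2 * ((m : ℝ) ^ 2 + (p : ℝ) ^ 2) := by
          have : 0 ≤ L * (k : ℝ) ^ 2 * (p : ℝ) ^ 2 := by positivity
          linarith
    have h3 : 1 ≤ L * k := by nlinarith
    exact ⟨h2, by nlinarith⟩
  obtain ⟨hW2, hW1⟩ := hW2
  have hW0 : 0 < W := by linarith
  have hb0 : 0 < b := by rw [hb]; positivity
  -- The perturbation of `N` is felt in all `m` response columns, hence the `m` in `z`. With `k` in
  -- `x`, the product of the two perturbations contributes `m * k * x * z = 1 / (4 * L ^ 2)`.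
  set x : ℝ := 1 / (2 * L * k) with hx
  set z : ℝ := 1 / (2 * L * m) with hz
  have hx0 : 0 < x := by positivity
  have hz0 : 0 < z := by positivity
  set K : ℝ := ((m : ℝ) + p) * J.card * (3 / 2 * Real.log (1.34 * L)) + frobSq (Matrix.of M) +
          frobSq (Matrix.of N) with hK
  set δ : ℝ := 1 / (L ^ 2 * k * m) with hδ
  set S : ℝ := frobSq X * (x * frobSq (Matrix.of N) + m * z * frobSq (Matrix.of M) + m * k * δ)
    with hS
  have main := integral_loss_gibbs_prior_le (l := l) (p := p) (m := m) (k := k) (X := X)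
    one_pos hb0 hlam (measurableSet_hyperSet J W)
    (δ := (1 / (22.17 * W)) ^ k) (K := K) (S := S) (by positivity)
    (le_hyperPrior_hyperSet J hW1 hb) (fun i => regFun X i (M, N)) ?_ y
  · refine main.trans ?_
    have e1 : Real.log ((1 / (22.17 * W)) ^ k) = -(k * Real.log (22.17 * W)) := by
      rw [Real.log_pow, one_div, Real.log_inv]; ring
    rw [e1, sub_neg_eq_add]
    have hF : 0 ≤ frobSq X := Finset.sum_nonneg fun i _ => Finset.sum_nonneg fun j _ => sq_nonneg _
    have hFN : 0 ≤ frobSq (Matrix.of N) :=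
      Finset.sum_nonneg fun i _ => Finset.sum_nonneg fun j _ => sq_nonneg _
    have e2 : S ≤ frobSq X *
        ((frobSq (Matrix.of N) + frobSq (Matrix.of M)) / (2 * L) + 1 / L ^ 2) := by
      refine mul_le_mul_of_nonneg_left ?_ hF
      have h1 : x ≤ 1 / (2 * L) := by
        rw [hx]; exact one_div_le_one_div_of_le (by positivity) (by nlinarith)
      have h2 : (m : ℝ) * z = 1 / (2 * L) := by rw [hz]; field_simp
      have h3 : (m : ℝ) * k * δ = 1 / L ^ 2 := by rw [hδ]; field_simp
      rw [h2, h3, add_div]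
      have h4 := mul_le_mul_of_nonneg_right h1 hFN
      have h5 : ∀ t : ℝ, 1 / (2 * L) * t = t / (2 * L) := fun t => by ring
      rw [h5] at h4 ⊢
      linarith
    linarith
  · intro γ hγ
    have hγJ : ∀ j, j ∈ J → γ j ∈ Set.Icc (1 / 2 : ℝ) 1 := fun j hj => by
      simpa only [if_pos hj] using hγ j (Set.mem_univ j)
    have hγn : ∀ j, j ∉ J → γ j ∈ Set.Ioc (0 : ℝ) (1 / W) := fun j hj => by
      simpa only [if_neg hj] using hγ j (Set.mem_univ j)
    -- Off `J` the comparison law keeps the conditional prior, so it has no entropy cost; its effect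
    -- on the loss is small because `γ j ≤ 1 / W`.
    set v : Fin k → ℝ≥0 := fun j => if j ∈ J then x.toNNReal else (γ j).toNNReal with hv
    set w : Fin k → ℝ≥0 := fun j => if j ∈ J then z.toNNReal else (γ j).toNNReal with hw
    refine ⟨(matGaussian M v).prod (matGaussian N w), inferInstance, ?_, fun y => ⟨?_, ?_⟩⟩
    · set κ := 3 / 2 * Real.log (1.34 * L)
      have hMK : LogDensityBound (colGaussian p k γ) (matGaussian M v)
          (∑ i, ∑ j, ((if j ∈ J then κ else 0) + M i j ^ 2)) := by
        refine logDensityBound_colGaussian fun i j => ?_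
        by_cases hj : j ∈ J
        · simp only [hv, if_pos hj]
          exact logDensityBound_entry hL1 hk1 (hkm1.trans hmL) (hγJ j hj) hx _
        · simpa only [hv, if_neg hj, hM j hj i, ne_eq, OfNat.ofNat_ne_zero, not_false_eq_true,
            zero_pow, add_zero] using LogDensityBound.refl _
      have hNK : LogDensityBound (colGaussian m k γ) (matGaussian N w)
          (∑ i, ∑ j, ((if j ∈ J then κ else 0) + N i j ^ 2)) := by
        refine logDensityBound_colGaussian fun i j => ?_
        by_cases hj : j ∈ J
        · simp only [hw, if_pos hj]
          exact logDensityBound_entry hL1 hm1 hmL (hγJ j hj) hz _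
        · simpa only [hw, if_neg hj, hN j hj i, ne_eq, OfNat.ofNat_ne_zero, not_false_eq_true,
            zero_pow, add_zero] using LogDensityBound.refl _
      refine (hMK.prod hNK).mono (le_of_eq ?_)
      simp only [Finset.sum_add_distrib, Finset.sum_ite_mem, Finset.univ_inter, Finset.sum_const,
        Finset.card_univ, Fintype.card_fin, nsmul_eq_mul]
      simp only [hK, frobSq, Matrix.of_apply]
      ring
    · exact integrable_finsetSum _ fun i _ => integrable_sq_sub_regFun X M N v w (y i) i
    · refine integral_loss_matGaussian_le X M N ?_ ?_ ?_ y
      -- Off `J` the entry of `N` vanishes, so the variance needs no bound by `x` there.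
      · intro h j
        by_cases hj : j ∈ J
        · simp only [hv, if_pos hj, Real.coe_toNNReal _ hx0.le, le_refl]
        · simp [hN j hj]
      · intro a j
        by_cases hj : j ∈ J
        · simp only [hw, if_pos hj, Real.coe_toNNReal _ hz0.le, le_refl]
        · simp [hM j hj]
      · intro j
        by_cases hj : j ∈ J
        · simp only [hv, hw, if_pos hj, Real.coe_toNNReal _ hx0.le, Real.coe_toNNReal _ hz0.le]
          rw [hx, hz, hδ, div_mul_div_comm, one_mul]
          refine one_div_le_one_div_of_le (by positivity) ?_
          have : 0 ≤ L ^ 2 * k * m := by positivity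
          nlinarith
        · have h0 : 0 < γ j := (hγn j hj).1
          have h1 : γ j ≤ 1 / W := (hγn j hj).2
          simp only [hv, hw, if_neg hj, Real.coe_toNNReal _ h0.le]
          have hsq : L ^ 2 * k * m ≤ W * W := by
            have h2 : 0 ≤ L * k * m := by positivity
            have h3 : (1 : ℝ) ≤ k * m := by nlinarith
            have h4 : L ^ 2 * (k * m) * 1 ≤ L ^ 2 * (k * m) * (k * m) := by gcongr
            nlinarith
          calc γ j * γ j ≤ 1 / W * (1 / W) := by gcongr
            _ = 1 / (W * W) := by rw [div_mul_div_comm, one_mul]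
            _ ≤ δ := one_div_le_one_div_of_le (by positivity) hsq

/-! ### Absolute convergence of the quasi-posterior mean -/

theorem gaussianPDFReal_zero_le {g : ℝ≥0} (hg : g ≠ 0) (t : ℝ) :
    gaussianPDFReal 0 g t ≤ 1 / √(g : ℝ) := by
  have hg' : (0 : ℝ) < g := by positivity
  have h1 : 1 ≤ √(2 * Real.pi) := Real.one_le_sqrt.2 (by linarith [Real.pi_gt_three])
  have h2 : Real.exp (-(t - 0) ^ 2 / (2 * g)) ≤ 1 := by
    rw [Real.exp_le_one_iff, neg_div]
    have : 0 ≤ (t - 0) ^ 2 / (2 * (g : ℝ)) := by positivity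
    linarith
  rw [gaussianPDFReal, Real.sqrt_mul (x := 2 * Real.pi) (by positivity), mul_inv, one_div]
  calc (√(2 * Real.pi))⁻¹ * (√(g : ℝ))⁻¹ * Real.exp (-(t - 0) ^ 2 / (2 * g))
      ≤ 1 * (√(g : ℝ))⁻¹ * 1 := by gcongr; exact inv_le_one_of_one_le₀ h1
    _ = _ := by ring

/-- In the scaled variable `u = |t| / √g` this follows from `u ≤ exp (u ^ 2 / 2)`. The bound is free
of `g`, as required when `γ` has infinite mean. -/
theorem abs_mul_gaussianPDFReal_zero_le {g : ℝ≥0} (hg : g ≠ 0) (t : ℝ) :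
    |t| * gaussianPDFReal 0 g t ≤ 1 := by
  have hg' : (0 : ℝ) < g := by positivity
  have hsg : 0 < √(g : ℝ) := by positivity
  have h1 : 1 ≤ √(2 * Real.pi) := Real.one_le_sqrt.2 (by linarith [Real.pi_gt_three])
  have h2 : |t| / √(g : ℝ) ≤ Real.exp (t ^ 2 / (2 * g)) := by
    have e : t ^ 2 / (2 * (g : ℝ)) = (|t| / √(g : ℝ)) ^ 2 / 2 := by
      rw [div_pow, Real.sq_sqrt hg'.le, sq_abs]; field_simp
    rw [e]
    nlinarith [Real.add_one_le_exp ((|t| / √(g : ℝ)) ^ 2 / 2), sq_nonneg (|t| / √(g : ℝ) - 1)]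
  have h3 : Real.exp (-(t - 0) ^ 2 / (2 * g)) = (Real.exp (t ^ 2 / (2 * g)))⁻¹ := by
    rw [← Real.exp_neg]; congr 1; ring
  rw [gaussianPDFReal, Real.sqrt_mul (x := 2 * Real.pi) (by positivity), mul_inv, h3]
  calc |t| * ((√(2 * Real.pi))⁻¹ * (√(g : ℝ))⁻¹ * (Real.exp (t ^ 2 / (2 * g)))⁻¹)
      = (√(2 * Real.pi))⁻¹ * (|t| / √(g : ℝ)) * (Real.exp (t ^ 2 / (2 * g)))⁻¹ := by
        field_simp
    _ ≤ 1 * Real.exp (t ^ 2 / (2 * g)) * (Real.exp (t ^ 2 / (2 * g)))⁻¹ := by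
        gcongr; exact inv_le_one_of_one_le₀ h1
    _ = 1 := by rw [one_mul, mul_inv_cancel₀ (Real.exp_ne_zero _)]

theorem lintegral_exp_neg_sq_sub {lam q : ℝ} (hlam : 0 < lam) (hq : q ≠ 0) (y : ℝ) :
    ∫⁻ t, ENNReal.ofReal (Real.exp (-lam * (y - q * t) ^ 2)) =
      ENNReal.ofReal (√(Real.pi / lam) / |q|) := by
  have hq2 : 0 < q ^ 2 := by positivity
  set V : ℝ := 1 / (2 * lam * q ^ 2) with hV
  have hV0 : 0 < V := by positivity
  have hVn : V.toNNReal ≠ 0 := by simpa using hV0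
  have e : ∀ t, Real.exp (-lam * (y - q * t) ^ 2)
      = √(Real.pi / lam) / |q| * gaussianPDFReal (y / q) V.toNNReal t := by
    intro t
    rw [gaussianPDFReal, Real.coe_toNNReal _ hV0.le]
    have h1 : -(t - y / q) ^ 2 / (2 * V) = -lam * (y - q * t) ^ 2 := by
      rw [hV]; field_simp; ring
    have h2 : √(2 * Real.pi * V) = √(Real.pi / lam) / |q| := by
      rw [← Real.sqrt_sq_eq_abs, ← Real.sqrt_div' _ hq2.le, hV]
      congr 1; field_simp
    rw [h1, h2]
    have h3 : √(Real.pi / lam) / |q| ≠ 0 := by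
      rw [← h2]; positivity
    field_simp
  simp only [e]
  have h4 : 0 ≤ √(Real.pi / lam) / |q| := by positivity
  simp only [ENNReal.ofReal_mul h4]
  rw [lintegral_const_mul _ (by fun_prop), lintegral_gaussianPDFReal_eq_one _ hVn, mul_one]

theorem lintegral_gaussianReal_le {g : ℝ≥0} (hg : g ≠ 0) {f h : ℝ → ℝ} (hf : Measurable f)
    (hle : ∀ t, gaussianPDFReal 0 g t * f t ≤ h t) :
    ∫⁻ t, ENNReal.ofReal (f t) ∂(gaussianReal 0 g) ≤ ∫⁻ t, ENNReal.ofReal (h t) := by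
  rw [gaussianReal_of_var_ne_zero _ hg, lintegral_withDensity_eq_lintegral_mul _
    (measurable_gaussianPDF _ _) (by fun_prop)]
  refine lintegral_mono fun t => ?_
  simp only [Pi.mul_apply, gaussianPDF]
  rw [← ENNReal.ofReal_mul (gaussianPDFReal_nonneg _ _ _)]
  exact ENNReal.ofReal_le_ofReal (hle t)

/-- The Gaussian integral in `t` is inversely proportional to `|c * n|`, and the prefactor `|n|`
cancels that dependence. -/
theorem lintegral_const_mul_exp_neg_sq_sub_le {lam c : ℝ} (hlam : 0 < lam) (hc : c ≠ 0) {d : ℝ}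
    (hd : 0 ≤ d) (y n : ℝ) :
    ∫⁻ t, ENNReal.ofReal (d * (|n| * Real.exp (-lam * (y - c * n * t) ^ 2))) ≤
      ENNReal.ofReal (d * (√(Real.pi / lam) / |c|)) := by
  by_cases hn : n = 0
  · simp [hn]
  simp only [ENNReal.ofReal_mul hd, ENNReal.ofReal_mul (abs_nonneg n)]
  rw [lintegral_const_mul _ (by fun_prop), lintegral_const_mul _ (by fun_prop),
    lintegral_exp_neg_sq_sub hlam (mul_ne_zero hc hn), ← ENNReal.ofReal_mul (abs_nonneg n)]
  refine le_of_eq ?_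
  congr 2
  rw [abs_mul]
  have : |n| ≠ 0 := abs_ne_zero.2 hn
  have : |c| ≠ 0 := abs_ne_zero.2 hc
  field_simp

theorem lintegral_abs_gaussianReal_le {g : ℝ≥0} (hg : g ≠ 0) :
    ∫⁻ t, ENNReal.ofReal |t| ∂(gaussianReal 0 g) ≤ ENNReal.ofReal √(g : ℝ) := by
  have hg' : (0 : ℝ) < g := by positivity
  have hsg : 0 < √(g : ℝ) := by positivity
  have hL : MemLp (fun t : ℝ => t) 2 (gaussianReal 0 g) := memLp_id_gaussianReal 2
  have hi : Integrable (fun t : ℝ => |t|) (gaussianReal 0 g) := (hL.integrable (by norm_num)).abs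
  rw [← ofReal_integral_eq_lintegral_ofReal hi (Filter.Eventually.of_forall fun t => abs_nonneg t)]
  refine ENNReal.ofReal_le_ofReal ?_
  have h2 : Integrable (fun t : ℝ => t ^ 2 * (1 / (2 * √(g : ℝ))) + √(g : ℝ) / 2)
      (gaussianReal 0 g) := (hL.integrable_sq.mul_const _).add (integrable_const _)
  have h3 : ∫ t, t ^ 2 ∂(gaussianReal 0 g) = g := by
    have h := variance_eq_sub hL
    rw [variance_fun_id_gaussianReal, integral_id_gaussianReal] at h
    simp only [Pi.pow_apply] at h
    linarith
  have h4 := integral_mono hi h2 fun t => ?_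
  · rw [integral_add (hL.integrable_sq.mul_const _) (integrable_const _), integral_mul_const,
      h3] at h4
    simp only [integral_const, probReal_univ, smul_eq_mul, one_mul] at h4
    have h5 : (g : ℝ) * (1 / (2 * √(g : ℝ))) = √(g : ℝ) / 2 := by
      have : (g : ℝ) = √(g : ℝ) * √(g : ℝ) := (Real.mul_self_sqrt hg'.le).symm
      nth_rewrite 1 [this]
      field_simp
    linarith
  · have : t ^ 2 * (1 / (2 * √(g : ℝ))) + √(g : ℝ) / 2 - |t|
        = (|t| - √(g : ℝ)) ^ 2 / (2 * √(g : ℝ)) := by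
      rw [← sq_abs t]; field_simp; ring
    have h0 : 0 ≤ (|t| - √(g : ℝ)) ^ 2 / (2 * √(g : ℝ)) := by positivity
    simp only
    linarith

theorem lintegral_colGaussian_le_of_update {q k : ℕ} (γ : Fin k → ℝ) (a : Fin q) (j : Fin k)
    {F G : (Fin q → Fin k → ℝ) → ℝ≥0∞} (hF : Measurable F) (hG : Measurable G)
    (h : ∀ U, ∫⁻ t, F (Function.update U a (Function.update (U a) j t))
      ∂(gaussianReal 0 (γ j).toNNReal) ≤ G U) :
    ∫⁻ U, F U ∂(colGaussian q k γ) ≤ ∫⁻ U, G U ∂(colGaussian q k γ) := by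
  have hp := measurePreserving_update
    (fun _ : Fin q => Measure.pi fun j => gaussianReal 0 (γ j).toNNReal) a
  rw [colGaussian, ← hp.lintegral_comp hF, ← hp.lintegral_comp hG,
    lintegral_prod (fun z => F (Function.update z.1 a z.2)) (hF.comp hp.measurable).aemeasurable,
    lintegral_prod (fun z => G (Function.update z.1 a z.2)) (hG.comp hp.measurable).aemeasurable]
  refine lintegral_mono fun U => ?_
  have hu : Measurable fun u : Fin k → ℝ => Function.update U a u :=
    hp.measurable.comp measurable_prodMk_left
  refine lintegral_pi_le_of_update _ j (hF.comp hu) fun u => ?_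
  simpa using h (Function.update U a u)

theorem regFun_update {l p m k : ℕ} (X : Matrix (Fin l) (Fin p) ℝ) (r : Fin l) (h : Fin m)
    (a : Fin p) (j : Fin k) (U : Fin p → Fin k → ℝ) (V : Fin m → Fin k → ℝ) (t : ℝ) :
    regFun X (r, h) (Function.update U a (Function.update (U a) j t), V) =
      regFun X (r, h) (Function.update U a (Function.update (U a) j 0), V) +
        X r a * V h j * t := by
  have e : ∀ a' j', Function.update U a (Function.update (U a) j t) a' j' =
      Function.update U a (Function.update (U a) j 0) a' j' +
        if a' = a then if j' = j then t else 0 else 0 := by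
    intro a' j'
    by_cases ha : a' = a
    · subst ha
      by_cases hj : j' = j
      · subst hj; simp
      · simp [hj]
    · simp [ha]
  simp only [regFun, mul_prodMat_apply, e, mul_add, Finset.sum_add_distrib, add_mul]
  congr 1
  simp [mul_right_comm]

/-- The entry `U a j` is integrated against the likelihood, where its slope is `X r a * V h j`; the
result cancels `|V h j|`. If `i = a`, the remaining `|t|` times the density is at most one.
Otherwise the density is at most `1 / √g`, which `𝔼|U i j| ≤ √g` compensates. Either way neither `γ`
nor `V` survives. -/
theorem lintegral_entry_mul_exp_le {l p m k : ℕ} {X : Matrix (Fin l) (Fin p) ℝ} {lam : ℝ}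
    (hlam : 0 < lam) {r : Fin l} {a : Fin p} (hX : X r a ≠ 0) (z : ℝ) (i : Fin p) (h : Fin m)
    (j : Fin k) (γ : Fin k → ℝ) (V : Fin m → Fin k → ℝ) :
    ∫⁻ U, ENNReal.ofReal (|U i j| * (|V h j| *
      Real.exp (-lam * (z - regFun X (r, h) (U, V)) ^ 2))) ∂(colGaussian p k γ) ≤
      ENNReal.ofReal (√(Real.pi / lam) / |X r a|) := by
  have hreg : Measurable fun U : Fin p → Fin k → ℝ => regFun X (r, h) (U, V) :=
    (measurable_regFun X (r, h)).comp measurable_prodMk_right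
  set F : (Fin p → Fin k → ℝ) → ℝ≥0∞ := fun U => ENNReal.ofReal (|U i j| * (|V h j| *
      Real.exp (-lam * (z - regFun X (r, h) (U, V)) ^ 2))) with hF
  have hFm : Measurable F := by fun_prop
  set C := √(Real.pi / lam) / |X r a| with hC
  have hC0 : 0 ≤ C := by positivity
  have hconst : ∫⁻ _U : Fin p → Fin k → ℝ, ENNReal.ofReal C ∂(colGaussian p k γ)
      = ENNReal.ofReal C := by simp
  -- For `γ j ≤ 0` the variance is truncated to zero, the law of `U i j` is a Dirac mass at zero,
  -- and the integrand vanishes almost surely.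
  by_cases hg : (γ j).toNNReal = 0
  · rw [← hconst]
    refine lintegral_colGaussian_le_of_update γ i j hFm measurable_const fun U => ?_
    simp [hg]
  have hg' : (0 : ℝ) < (γ j).toNNReal := by positivity
  obtain ⟨y0, hz⟩ : ∃ y0 : (Fin p → Fin k → ℝ) → ℝ, ∀ U t,
      z - regFun X (r, h) (Function.update U a (Function.update (U a) j t), V) =
      y0 U - X r a * V h j * t :=
    ⟨fun U => z - regFun X (r, h) (Function.update U a (Function.update (U a) j 0), V),
      fun U t => by rw [regFun_update]; ring⟩
  by_cases hi : i = a
  · subst hi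
    rw [← hconst]
    refine lintegral_colGaussian_le_of_update γ i j hFm measurable_const fun U => ?_
    simp only [Function.update_self, hz]
    refine (lintegral_gaussianReal_le hg (h := fun t => 1 * (|V h j| *
      Real.exp (-lam * (y0 U - X r i * V h j * t) ^ 2))) ?_ ?_).trans ?_
    · fun_prop
    · intro t
      rw [← mul_assoc, mul_comm (gaussianPDFReal _ _ _)]
      exact mul_le_mul_of_nonneg_right (abs_mul_gaussianPDFReal_zero_le hg t) (by positivity)
    · exact (lintegral_const_mul_exp_neg_sq_sub_le hlam hX zero_le_one _ _).trans
        (by rw [one_mul])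
  · have hs : 0 < √((γ j).toNNReal : ℝ) := Real.sqrt_pos.2 hg'
    calc ∫⁻ U, F U ∂(colGaussian p k γ)
        ≤ ∫⁻ U, ENNReal.ofReal (|U i j| * (1 / √((γ j).toNNReal : ℝ) * C))
            ∂(colGaussian p k γ) := by
          refine lintegral_colGaussian_le_of_update γ a j hFm (by fun_prop) fun U => ?_
          simp only [hF, Function.update_of_ne hi, hz]
          refine (lintegral_gaussianReal_le hg (h := fun t => (|U i j| *
            (1 / √((γ j).toNNReal : ℝ))) * (|V h j| *
            Real.exp (-lam * (y0 U - X r a * V h j * t) ^ 2))) ?_ ?_).trans ?_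
          · fun_prop
          · intro t
            rw [← mul_assoc, mul_comm (gaussianPDFReal _ _ _)]
            exact mul_le_mul_of_nonneg_right (mul_le_mul_of_nonneg_left
              (gaussianPDFReal_zero_le hg t) (abs_nonneg _)) (by positivity)
          · exact (lintegral_const_mul_exp_neg_sq_sub_le hlam hX (by positivity) _ _).trans
              (by rw [mul_assoc])
      _ = (∫⁻ U, ENNReal.ofReal |U i j| ∂(colGaussian p k γ)) *
            ENNReal.ofReal (1 / √((γ j).toNNReal : ℝ) * C) := by
          simp only [ENNReal.ofReal_mul (abs_nonneg _)]
          rw [lintegral_mul_const _ (by fun_prop)]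
      _ ≤ ENNReal.ofReal √((γ j).toNNReal : ℝ) *
            ENNReal.ofReal (1 / √((γ j).toNNReal : ℝ) * C) := by
          gcongr
          have hc : ∫⁻ _U : Fin p → Fin k → ℝ, ENNReal.ofReal √((γ j).toNNReal : ℝ)
              ∂(colGaussian p k γ) = ENNReal.ofReal √((γ j).toNNReal : ℝ) := by simp
          rw [← hc]
          refine lintegral_colGaussian_le_of_update γ i j (by fun_prop) measurable_const
            fun U => ?_
          simpa only [Function.update_self] using lintegral_abs_gaussianReal_le hg
      _ = ENNReal.ofReal C := by
          rw [← ENNReal.ofReal_mul hs.le]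
          congr 1
          field_simp

theorem prodMat_apply {p m k : ℕ} (θ : Pairs p m k) (i : Fin p) (h : Fin m) :
    prodMat θ i h = ∑ j, θ.1 i j * θ.2 h j := by
  simp [prodMat, Matrix.mul_apply]

theorem frobSq_sub_mul_prodMat {l p m k : ℕ} (X : Matrix (Fin l) (Fin p) ℝ)
    (Z : Matrix (Fin l) (Fin m) ℝ) (θ : Pairs p m k) :
    frobSq (Z - X * prodMat θ) = ∑ ih : Fin l × Fin m, (Z ih.1 ih.2 - regFun X ih θ) ^ 2 := by
  rw [Fintype.sum_prod_type]; rfl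

theorem quasiPosterior_eq_gibbs {l p m k : ℕ} (X : Matrix (Fin l) (Fin p) ℝ) {a b lam : ℝ}
    (Z : Matrix (Fin l) (Fin m) ℝ) :
    quasiPosterior k a b lam X Z =
      gibbs (prior p m k a b) (regFun X) lam fun ih => Z ih.1 ih.2 := by
  simp only [quasiPosterior, gibbs, frobSq_sub_mul_prodMat]

/-- The quasi-posterior mean of `M Nᵀ` converges absolutely, although the prior mean does not. -/
theorem integrable_prodMat_quasiPosterior {l p m k : ℕ} {X : Matrix (Fin l) (Fin p) ℝ}
    (hX : X ≠ 0) {a b lam : ℝ} (ha : 0 < a) (hb : 0 < b) (hlam : 0 < lam)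
    (Z : Matrix (Fin l) (Fin m) ℝ) (i : Fin p) (h : Fin m) :
    Integrable (fun θ => prodMat θ i h) (quasiPosterior k a b lam X Z) := by
  obtain ⟨r, a0, hXr⟩ : ∃ r a0, X r a0 ≠ 0 := by
    by_contra! hcon
    exact hX (Matrix.ext hcon)
  have hprob := isProbabilityMeasure_prior p m k ha hb
  have hφ := fun ih => measurable_regFun (k := k) (m := m) X ih
  have hpm : Measurable fun θ : Pairs p m k => prodMat θ i h := by
    simp only [prodMat_apply]; fun_prop
  set y : Fin l × Fin m → ℝ := fun ih => Z ih.1 ih.2 with hy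
  rw [quasiPosterior_eq_gibbs, gibbs, integrable_tilted_iff (integrable_exp_neg_loss hφ hlam _)]
  set H : Pairs p m k → ℝ := fun θ =>
    Real.exp (-lam * ∑ ih, (y ih - regFun X ih θ) ^ 2) • prodMat θ i h with hH
  have hHm : Measurable H := by simp only [hH, smul_eq_mul]; fun_prop
  refine ⟨hHm.aestronglyMeasurable, ?_⟩
  set T : Fin k → Pairs p m k → ℝ≥0∞ := fun j θ => ENNReal.ofReal (|θ.1 i j| * (|θ.2 h j| *
      Real.exp (-lam * (y (r, h) - regFun X (r, h) θ) ^ 2))) with hT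
  have hTm : ∀ j, Measurable (T j) := fun j => by have := hφ (r, h); fun_prop
  set C := √(Real.pi / lam) / |X r a0|
  have hle : ∀ θ, ‖H θ‖ₑ ≤ ∑ j, T j θ := by
    intro θ
    rw [← ofReal_norm, ← ENNReal.ofReal_sum_of_nonneg fun j _ => by positivity]
    refine ENNReal.ofReal_le_ofReal ?_
    rw [hH, norm_smul, Real.norm_eq_abs, Real.norm_eq_abs, abs_of_pos (Real.exp_pos _),
      prodMat_apply, mul_comm]
    -- One square is enough: the one in column `h` of the response, since it involves the same row
    -- of `N` as the entry `(i, h)` of the product.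
    have h1 : (y (r, h) - regFun X (r, h) θ) ^ 2 ≤ ∑ ih, (y ih - regFun X ih θ) ^ 2 :=
      Finset.single_le_sum (f := fun ih => (y ih - regFun X ih θ) ^ 2)
        (fun _ _ => sq_nonneg _) (Finset.mem_univ _)
    calc |∑ j, θ.1 i j * θ.2 h j| * Real.exp (-lam * ∑ ih, (y ih - regFun X ih θ) ^ 2)
        ≤ (∑ j, |θ.1 i j| * |θ.2 h j|) *
            Real.exp (-lam * (y (r, h) - regFun X (r, h) θ) ^ 2) := by
          refine mul_le_mul ?_ (Real.exp_le_exp.2 (by nlinarith)) (Real.exp_nonneg _)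
            (Finset.sum_nonneg fun j _ => by positivity)
          refine (Finset.abs_sum_le_sum_abs _ _).trans (le_of_eq ?_)
          exact Finset.sum_congr rfl fun j _ => abs_mul _ _
      _ = _ := by
          rw [Finset.sum_mul]; exact Finset.sum_congr rfl fun j _ => mul_assoc _ _ _
  have hγ : ∀ γ : Fin k → ℝ, ∫⁻ θ, ‖H θ‖ₑ ∂(priorGiven p m k γ) ≤ k * ENNReal.ofReal C := by
    intro γ
    calc ∫⁻ θ, ‖H θ‖ₑ ∂(priorGiven p m k γ)
        ≤ ∫⁻ θ, ∑ j, T j θ ∂(priorGiven p m k γ) := lintegral_mono hle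
      _ = ∑ j, ∫⁻ θ, T j θ ∂(priorGiven p m k γ) := lintegral_finsetSum _ fun j _ => hTm j
      _ ≤ ∑ _j : Fin k, ENNReal.ofReal C := by
          refine Finset.sum_le_sum fun j _ => ?_
          rw [priorGiven, lintegral_prod_symm' _ (hTm j)]
          calc _ ≤ ∫⁻ _V : Fin m → Fin k → ℝ, ENNReal.ofReal C ∂(colGaussian m k γ) :=
                lintegral_mono fun V => lintegral_entry_mul_exp_le hlam hXr _ i h j γ V
            _ = _ := by simp
      _ = _ := by simp
  rw [HasFiniteIntegral, prior, Measure.lintegral_bind (measurable_priorGiven p m k).aemeasurable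
    hHm.enorm.aemeasurable]
  have hgm := isProbabilityMeasure_gammaMeasure ha hb
  have h1 : IsProbabilityMeasure (invGammaMeasure a b) :=
    Measure.isProbabilityMeasure_map (by fun_prop)
  have h2 : IsProbabilityMeasure (hyperPrior k a b) := by unfold hyperPrior; infer_instance
  calc _ ≤ ∫⁻ _γ : Fin k → ℝ, k * ENNReal.ofReal C ∂(hyperPrior k a b) := lintegral_mono hγ
    _ < ⊤ := by
      simp [ENNReal.mul_lt_top]

/-! ### From the matrix model to the abstract regression model. -/

theorem exists_steinBound_law {l m : ℕ} (hl : 1 ≤ l) (hm : 1 ≤ m) {Ω : Type*} [MeasurableSpace Ω]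
    {P : Measure Ω} [IsProbabilityMeasure P] {E : Fin l → Fin m → Ω → ℝ} {s : ℝ}
    (hE : GaussianNoise P E s ∨ BoundedNoise P E s) :
    ∃ ν : Measure ℝ, IsProbabilityMeasure ν ∧ SteinBound ν (s ^ 2) ∧
      HasLaw (fun ω (ij : Fin l × Fin m) => E ij.1 ij.2 ω) (Measure.pi fun _ => ν) P := by
  rcases hE with ⟨hind, v, hv, hlaw⟩ | ⟨hind, ζ, fmin, f, ν, hf, hfmin, hle, hν, hlaw, h0, hs⟩
  · exact ⟨_, inferInstance, (steinBound_gaussianReal v).mono hv,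
      hind.hasLaw_pi fun ij => hlaw ij.1 ij.2⟩
  · have hprob : IsProbabilityMeasure ν :=
      (hlaw ⟨0, hl⟩ ⟨0, hm⟩).isProbabilityMeasure_iff.1 inferInstance
    exact ⟨ν, hprob, (steinBound_of_density hf hfmin hle hν h0).mono hs,
      hind.hasLaw_pi fun ij => hlaw ij.1 ij.2⟩

theorem mul_estimator_apply {l p m k : ℕ} (X : Matrix (Fin l) (Fin p) ℝ) {a b lam : ℝ}
    (ha : 0 < a) (hb : 0 < b) (hlam : 0 < lam) (Z : Matrix (Fin l) (Fin m) ℝ) (i : Fin l)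
    (h : Fin m) :
    (X * estimator k a b lam X Z) i h =
      ∫ θ, regFun X (i, h) θ ∂(gibbs (prior p m k a b) (regFun X) lam fun ih => Z ih.1 ih.2) := by
  rw [← quasiPosterior_eq_gibbs]
  simp only [regFun, Matrix.mul_apply, estimator, Matrix.of_apply]
  -- For `X = 0` both sides are zero, whatever value is given to a possibly divergent integral.
  -- Otherwise absolute convergence lets `X` pass under the integral.
  by_cases hX : X = 0
  · simp [hX]
  rw [integral_finsetSum _ fun c _ =>
    (integrable_prodMat_quasiPosterior hX ha hb hlam Z c h).const_mul _]
  exact Finset.sum_congr rfl fun c _ => (integral_const_mul _ _).symm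

theorem frobSq_nonneg {q r : ℕ} (A : Matrix (Fin q) (Fin r) ℝ) : 0 ≤ frobSq A :=
  Finset.sum_nonneg fun _ _ => Finset.sum_nonneg fun _ _ => sq_nonneg _

end ReducedRank

theorem theorem1 {l p m k : ℕ} (hl : 1 ≤ l) (hk : 1 ≤ k) (hkpm : k ≤ min p m)
    {Ω : Type*} [MeasurableSpace Ω] (P : Measure Ω) [IsProbabilityMeasure P]
    (X : Matrix (Fin l) (Fin p) ℝ) (B : Matrix (Fin p) (Fin m) ℝ)
    (E : Fin l → Fin m → Ω → ℝ) (s : ℝ) (hs : 0 < s)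
    (hsm : s ^ 2 * √(m : ℝ) ≤ (l : ℝ) * p)
    (hE : ReducedRank.GaussianNoise P E s ∨ ReducedRank.BoundedNoise P E s)
    (a b lam : ℝ) (ha : a = 1)
    (hb : b = s ^ 2 / (2 * (l : ℝ) * p * (k : ℝ) ^ 2 * ((m : ℝ) ^ 2 + (p : ℝ) ^ 2)))
    (hlam : lam = 1 / (4 * s ^ 2))
    (Y : Ω → Matrix (Fin l) (Fin m) ℝ)
    (hY : ∀ ω, Y ω = X * B + ReducedRank.noiseMat E ω) :
    (X ≠ 0 → ∀ (Z : Matrix (Fin l) (Fin m) ℝ) (i : Fin p) (h : Fin m),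
      Integrable (fun θ => ReducedRank.prodMat θ i h)
        (ReducedRank.quasiPosterior k a b lam X Z)) ∧
    Integrable (fun ω => ReducedRank.frobSq
      (X * ReducedRank.estimator k a b lam X (Y ω) - X * B)) P ∧
    ∀ (J : Finset (Fin k)) (M : Matrix (Fin p) (Fin k) ℝ) (N : Matrix (Fin m) (Fin k) ℝ),
      (∀ j, j ∉ J → (∀ i, M i j = 0) ∧ (∀ h, N h j = 0)) →
      ∫ ω, ReducedRank.frobSq (X * ReducedRank.estimator k a b lam X (Y ω) - X * B) ∂P ≤
        ReducedRank.frobSq (X * (M * Nᵀ - B))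
        + 6 * s ^ 2 * ((m : ℝ) + p) * (J.card : ℝ) * Real.log (1.34 * l * p / s ^ 2)
        + 8 * s ^ 2 * k *
            Real.log (22.17 * l * p * (k : ℝ) ^ 2 * ((m : ℝ) ^ 2 + (p : ℝ) ^ 2) / s ^ 2)
        + 2 * s ^ 2 * ReducedRank.frobSq X / ((l : ℝ) * p) *
            (ReducedRank.frobSq N + ReducedRank.frobSq M + 2 * s ^ 2 / ((l : ℝ) * p) + 16 * s ^ 2)
        + 8 * s ^ 2 * (ReducedRank.frobSq N + ReducedRank.frobSq M + Real.log 2) := by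
  open ReducedRank in
  have hm : 1 ≤ m := hk.trans (hkpm.trans (min_le_right _ _))
  have hp : 1 ≤ p := hk.trans (hkpm.trans (min_le_left _ _))
  have hl0 : (0 : ℝ) < l := by exact_mod_cast hl
  have hk0 : (0 : ℝ) < k := by exact_mod_cast hk
  have hm0 : (0 : ℝ) < m := by exact_mod_cast hm
  have hp0 : (0 : ℝ) < p := by exact_mod_cast hp
  have hs2 : 0 < s ^ 2 := by positivity
  have hb0 : 0 < b := by rw [hb]; positivity
  have hlam0 : 0 < lam := by rw [hlam]; positivity
  subst ha
  refine ⟨fun hX Z i h => integrable_prodMat_quasiPosterior hX one_pos hb0 hlam0 Z i h, ?_⟩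
  obtain ⟨ν, hν, hstein, hlaw⟩ := exists_steinBound_law hl hm hE
  -- In terms of `L` and `W` the assumption on `s` reads `√m ≤ L` and the hyperparameter is `b = 1 /
  -- (2 * W)`.
  set L : ℝ := l * p / s ^ 2 with hL
  set W : ℝ := L * (k : ℝ) ^ 2 * ((m : ℝ) ^ 2 + (p : ℝ) ^ 2) with hW
  have hL0 : 0 < L := by positivity
  have hbW : b = 1 / (2 * W) := by rw [hb, hW, hL]; field_simp
  have hmL : √(m : ℝ) ≤ L := by rw [hL, le_div_iff₀ hs2]; linarith
  have hc : 4 * lam * s ^ 2 ≤ 1 := by rw [hlam]; refine le_of_eq ?_; field_simp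
  have := isProbabilityMeasure_prior p m k one_pos hb0
  set f : Fin l × Fin m → ℝ := fun ih => (X * B) ih.1 ih.2 with hf
  set μ := prior p m k 1 b with hμ
  set risk : (Fin l × Fin m → ℝ) → ℝ := fun x =>
    ∑ i, (∫ θ, regFun X i θ ∂(gibbs μ (regFun X) lam (f + x)) - f i) ^ 2 with hrisk
  have hωrisk : (fun ω => frobSq (X * estimator k 1 b lam X (Y ω) - X * B)) =
      fun ω => risk fun ij => E ij.1 ij.2 ω := by
    ext ω
    simp only [hrisk]
    rw [Fintype.sum_prod_type]
    simp only [frobSq, Matrix.sub_apply]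
    refine Finset.sum_congr rfl fun i _ => Finset.sum_congr rfl fun h _ => ?_
    rw [mul_estimator_apply X one_pos hb0 hlam0]
    simp only [hY]
    rfl
  have oracle := fun (M : Fin p → Fin k → ℝ) (N : Fin m → Fin k → ℝ) (J : Finset (Fin k))
      (hM : ∀ j, j ∉ J → ∀ i, M i j = 0) (hN : ∀ j, j ∉ J → ∀ h, N h j = 0) =>
    oracle_inequality (μ := μ) (fun i => measurable_regFun (k := k) X i) hlam0 hstein hc f
      (integral_loss_gibbs_le X hM hN hk (hkpm.trans (min_le_right _ _)) hmL hW hbW hlam0)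
  -- Integrability does not depend on the comparison pair, so the zero pair with empty `J` will do.
  have hint : Integrable risk (Measure.pi fun _ => ν) :=
    (oracle 0 0 ∅ (fun _ _ _ => rfl) fun _ _ _ => rfl).1
  rw [hωrisk]
  refine ⟨?_, fun J M N hMN => ?_⟩
  · have := hint
    rw [← hlaw.map_eq] at this
    exact this.comp_aemeasurable hlaw.aemeasurable
  have hval : ∫ ω, risk (fun ij => E ij.1 ij.2 ω) ∂P = ∫ x, risk x ∂(Measure.pi fun _ => ν) :=
    hlaw.integral_comp hint.aestronglyMeasurable
  rw [hval]
  refine (oracle M N J (fun j hj => (hMN j hj).1) fun j hj => (hMN j hj).2).2.trans ?_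
  have e1 : ∑ i, (f i - regFun X i (M, N)) ^ 2 = frobSq (X * (M * Nᵀ - B)) := by
    rw [Fintype.sum_prod_type, Matrix.mul_sub]
    simp only [frobSq, Matrix.sub_apply]
    refine Finset.sum_congr rfl fun i _ => Finset.sum_congr rfl fun h _ => ?_
    change ((X * B) i h - (X * (M * Nᵀ)) i h) ^ 2 = _
    ring
  have e2 : 1.34 * (l : ℝ) * p / s ^ 2 = 1.34 * L := by rw [hL]; ring
  have e3 : 22.17 * (l : ℝ) * p * (k : ℝ) ^ 2 * ((m : ℝ) ^ 2 + (p : ℝ) ^ 2) / s ^ 2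
      = 22.17 * W := by rw [hW, hL]; ring
  have e4 : 2 * s ^ 2 * frobSq X / ((l : ℝ) * p) = 2 / L * frobSq X := by
    rw [hL]; field_simp
  have e5 : 2 * s ^ 2 / ((l : ℝ) * p) = 2 / L := by rw [hL]; field_simp
  rw [e1, e2, e3, e4, e5]
  change _ + (frobSq X * ((frobSq N + frobSq M) / (2 * L) + 1 / L ^ 2) +
    (((m : ℝ) + p) * J.card * (3 / 2 * Real.log (1.34 * L)) + frobSq M + frobSq N
      + k * Real.log (22.17 * W)) / lam) ≤ _
  have hFX := frobSq_nonneg X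
  have hFM := frobSq_nonneg M
  have hFN := frobSq_nonneg N
  have hL1 : 1 ≤ L := (Real.one_le_sqrt.2 (by exact_mod_cast hm)).trans hmL
  have hW1 : 1 ≤ 22.17 * W := by
    have hk1 : (1 : ℝ) ≤ k := by exact_mod_cast hk
    have hm1 : (1 : ℝ) ≤ m := by exact_mod_cast hm
    have h1 : (1 : ℝ) ≤ L * (k : ℝ) ^ 2 := one_le_mul_of_one_le_of_one_le hL1 (one_le_pow₀ hk1)
    have h2 : (1 : ℝ) ≤ (m : ℝ) ^ 2 + (p : ℝ) ^ 2 := by nlinarith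
    have h3 := one_le_mul_of_one_le_of_one_le h1 h2
    linarith
  have hlogW := Real.log_nonneg hW1
  have hlog2 := Real.log_nonneg one_le_two
  have h1 : frobSq X * ((frobSq N + frobSq M) / (2 * L) + 1 / L ^ 2) ≤
      2 / L * frobSq X * (frobSq N + frobSq M + 2 / L + 16 * s ^ 2) := by
    have e : 2 / L * frobSq X * (frobSq N + frobSq M + 2 / L + 16 * s ^ 2) -
        frobSq X * ((frobSq N + frobSq M) / (2 * L) + 1 / L ^ 2) =
        frobSq X * ((frobSq N + frobSq M) * (3 / (2 * L)) + 3 / L ^ 2 + 32 * s ^ 2 / L) := by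
      field_simp; ring
    have : 0 ≤ frobSq X * ((frobSq N + frobSq M) * (3 / (2 * L)) + 3 / L ^ 2 +
      32 * s ^ 2 / L) := by positivity
    linarith
  -- Since `1 / lam = 4 * s ^ 2`, the factor `3 / 2` becomes exactly the `6` of the bound. The other
  -- terms come with `4` where the bound has `8`, and the difference is nonnegative.
  have h2 : (((m : ℝ) + p) * J.card * (3 / 2 * Real.log (1.34 * L)) + frobSq M + frobSq N
      + k * Real.log (22.17 * W)) / lam =
      6 * s ^ 2 * ((m : ℝ) + p) * J.card * Real.log (1.34 * L) +
        4 * s ^ 2 * (frobSq N + frobSq M) + 4 * s ^ 2 * k * Real.log (22.17 * W) := by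
    rw [hlam]; field_simp; ring
  have h3 : 0 ≤ s ^ 2 * (frobSq N + frobSq M) := by positivity
  have h4 : 0 ≤ s ^ 2 * k * Real.log (22.17 * W) := by positivity
  have h5 : 0 ≤ s ^ 2 * Real.log 2 := by positivity
  rw [h2]
  linarith
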